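/- Let $\mathfrak g$ be a complex semisimple Lie algebra with Cartan subalgebra $\mathfrak h$, root system $R$ and a chosen base of $R$, and let $V$ be a faithful finite-dimensional irreducible $\mathfrak g$-module of highest weight $\chi$. Let $L_V^*=\{h\in\mathfrak h:\mu(h)\in\mathbb Z \text{ for all weights }\mu\text{ of }V\}$ and $(L_V^*)_+=\{h\in L_V^*:\alpha(h)\ge 0\text{ for all }\alpha\in R^+\}$. For a field $F$ with $\mathbb C\subseteq F\subseteq\mathbb C((z))$ let $G(F)$ be the Chevalley group of $(\mathfrak g,V)$ over $F$, i.e. the group of automorphisms generated by the $\exp(tX_\alpha)$ ($X_\alpha$ a root vector, $t\in F$) and the torus elements $t^h$ ($t\in F^\times$, $h\in L_V^*$), where $t^h$ multiplies vectors of weight $\mu$ by $t^{\mu(h)}$. Let $K=G(\mathbb C[[z]])$ be the subgroup of $G(\mathbb C((z)))$ preserving $V[[z]]$. For $h\in L_V^*$ put $V_i=\{v\in V: hv=-iv\}$, $F_j^h=\bigoplus_{s\le j}V_s$ and $\mathcal F_h=\{\sum_j f_jz^j\in V((z)): f_j\in F^h_j\ \forall j\}$. Let $\Sigma$ be a Riemann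 surface with a holomorphic local coordinate $z$ fixed at each of its points, $\Gamma\subset\Sigma$ a finite set and $h=(h_\gamma)_{\gamma\in\Gamma}$ with $h_\gamma\in(L_V^*)_+$. A distribution with support $\Gamma$ assigns to every $x\in\Sigma$ a germ $\Psi_x$ of a meromorphic $G$-valued function (an element of $G$ over the field of convergent Laurent series in $z$), holomorphic for $x\notin\Gamma$; a matrix divisor is a class of distributions modulo left multiplication by everywhere holomorphic distributions. It has toric invariants $h$ if, for every $\gamma\in\Gamma$, $\Psi_\gamma=kz^{h_\gamma}k'$ with $k,k'$ germs of holomorphic $G$-valued functions. Its sections over an open $U\subseteq\Sigma$ are the meromorphic $V$-valued functions $f$ on $U$, holomorphic on $U\setminus\Gamma$, such that $\Psi_\gamma f$ is holomorphic near each $\gamma\in U\cap\Gamma$. Let $\mathcal M^{\chi,\Gamma}_h$ be the set of matrix divisors with invariants $h$, where two of them are identified if they have the same sheaf of sections. For $\gamma\in\Gamma$ let $G_\gamma=\{g\in G(\mathbb C((z))): g\mathcal F_{h_\gamma}=\mathcal F_{h_\gamma}\}$ be the stabilizer of the flag determined by $h_\gamma$, let $K_\gamma=K\cap G_\gamma$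 and $K_0=\prod_{\gamma\in\Gamma}K_\gamma$. Then $\mathcal M^{\chi,\Gamma}_h$ is the homogeneous space $$\mathcal M^{\chi,\Gamma}_h\;\cong\;\underbrace{K\times\dots\times K}_{|\Gamma|\text{ times}}/K_0 .$$ More precisely: (1) $K^{\Gamma}$ acts on $\mathcal M^{\chi,\Gamma}_h$ by $(k,\Psi)\mapsto\Psi k^{-1}$, i.e. $k\cdot[\Psi]=[\Psi']$ if and only if $\Psi'_\gamma k_\gamma\Psi_\gamma^{-1}\in K$ for all $\gamma\in\Gamma$. (2) There is a $K^\Gamma$-equivariant bijection $e:K^\Gamma/K_0\to\mathcal M^{\chi,\Gamma}_h$ such that the sections over $U$ of $e(kK_0)$ are the meromorphic $V$-valued functions on $U$, holomorphic on $U\setminus\Gamma$, whose Laurent expansion at each $\gamma\in U\cap\Gamma$ lies in $k_\gamma\mathcal F_{h_\gamma}$. (3) For $g\in G(\mathbb C)$, the sheaf of sections of $m'\in\mathcal M^{\chi,\Gamma}_h$ is the shift $f\mapsto gf$ of that of $m$ if and only if $m'=(g,\dots,g)\cdot m$. Hence the classes of matrix divisors up to a common left shift of the sheaf of sections by a constant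 element of $G$ are the orbits of the diagonal $G(\mathbb C)\subset K^\Gamma$ on $K^\Gamma/K_0$. -/

import Mathlib

open scoped Manifold ContDiff TensorProduct Topology Pointwise LaurentSeries

noncomputable section

namespace MatrixDivisors

/-! ### Laurent series with coefficients in a vector space -/

section Laurent

/-- The `ℂ`-algebra structure on `ℂ((z))` with coefficientwise scalar multiplication (declared here
so that it is preferred to the one that Mathlib derives from the power series ring). -/
instance laurentAlgebra : Algebra ℂ ℂ⸨X⸩ := HahnSeries.instAlgebra

variable (V : Type*) [AddCommGroup V] [Module ℂ V]

/-- For a finite dimensional `V` this is the space `V((z))` of formal Laurent series in `z` with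
coefficients in `V`, viewed as a vector space over the field `ℂ((z))`. -/
abbrev LaurentModule : Type _ := ℂ⸨X⸩ ⊗[ℂ] V

/-- The group `GL(V((z)))` of `ℂ((z))`-linear automorphisms. -/
abbrev LoopGL : Type _ := LinearMap.GeneralLinearGroup ℂ⸨X⸩ (LaurentModule V)

variable {V}

/-- The coefficient `s_n ∈ V` of `s = ∑ s_n z^n ∈ V((z))`. -/
def vcoeff (n : ℤ) : LaurentModule V →ₗ[ℂ] V :=
  (TensorProduct.lid ℂ V).toLinearMap ∘ₗ
    LinearMap.rTensor V (HahnSeries.coeff.linearMap (R := ℂ) (V := ℂ) n)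

/-- The formal Laurent series with a positive radius of convergence, i.e. the expansions of germs
of meromorphic functions. -/
def convergent : Set ℂ⸨X⸩ :=
  {a | ∃ r : ℝ, 0 < r ∧ Summable fun n : ℕ => ‖a.coeff (n : ℤ)‖ * r ^ n}

/-- The series `z ∈ ℂ((z))`. -/
def zSeries : ℂ⸨X⸩ := HahnSeries.single 1 1

variable (V) in
/-- The lattice `V[[z]]` in `V((z))`. -/
def taylorLattice : Submodule ℂ (LaurentModule V) where
  carrier := {s | ∀ n : ℤ, n < 0 → vcoeff n s = 0}
  add_mem' ha hb n hn := by rw [map_add, ha n hn, hb n hn, add_zero]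
  zero_mem' n _ := map_zero _
  smul_mem' c x hx n hn := by rw [map_smul, hx n hn, smul_zero]

end Laurent

/-! ### The Chevalley group -/

section Chevalley

variable {𝔤 : Type*} [LieRing 𝔤] [LieAlgebra ℂ 𝔤] [FiniteDimensional ℂ 𝔤]
  [LieAlgebra.IsSemisimple ℂ 𝔤]
  (H : LieSubalgebra ℂ 𝔤) [H.IsCartanSubalgebra]
  (V : Type*) [AddCommGroup V] [Module ℂ V] [LieRingModule 𝔤 V] [LieModule ℂ 𝔤 V]
  [FiniteDimensional ℂ V]

/-- `exp (t x) = ∑ t^n x^n / n!` as an endomorphism of `V((z))`, for an element `x` of `𝔤` that acts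
nilpotently on `V` (the sum is finite). -/
def expEnd (x : 𝔤) (t : ℂ⸨X⸩) : Module.End ℂ⸨X⸩ (LaurentModule V) :=
  ∑ n ∈ Finset.range (nilpotencyClass (LieModule.toEnd ℂ 𝔤 V x)),
    (algebraMap ℂ ℂ⸨X⸩ ((n.factorial : ℂ)⁻¹) * t ^ n) •
      LinearMap.baseChange ℂ⸨X⸩ ((LieModule.toEnd ℂ 𝔤 V x) ^ n)

/-- The lattice `L_V^*`: the elements of the Cartan subalgebra on which all weights of `V` take
integer values. -/
def dualWeightLattice : Set H :=
  {h | ∀ μ : LieModule.Weight ℂ H V, ∃ n : ℤ, μ h = (n : ℂ)}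

/-- `u = t^h`: the automorphism `u` of `V((z))` multiplies every vector of weight `μ` by
`t ^ μ(h)`. As `V` is spanned by weight vectors, this determines `u`. -/
def IsTorusElement (h : H) (t : ℂ⸨X⸩) (u : LoopGL V) : Prop :=
  ∀ (μ : LieModule.Weight ℂ H V) (n : ℤ), μ h = (n : ℂ) →
    ∀ v ∈ LieModule.weightSpace V (μ : H → ℂ),
      (u : Module.End ℂ⸨X⸩ (LaurentModule V)) (1 ⊗ₜ[ℂ] v) = (t ^ n) ⊗ₜ[ℂ] v

/-- The subgroup of `GL(V((z)))` generated by the root elements `exp (t x)`, `x` a root vector, and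
the elements `t^h`, `t ≠ 0`, `h ∈ L_V^*`, of the maximal torus, with all parameters `t` in `T`. For
`T` a subfield of `ℂ((z))` this is the Chevalley group of `(𝔤, V)` over `T`. -/
def chevalley (T : Set ℂ⸨X⸩) : Subgroup (LoopGL V) :=
  Subgroup.closure
    ({u | ∃ α ∈ H.root, ∃ x ∈ LieAlgebra.rootSpace H α, ∃ t ∈ T,
        (u : Module.End ℂ⸨X⸩ (LaurentModule V)) = expEnd V x t} ∪
     {u | ∃ h ∈ dualWeightLattice H V, ∃ t ∈ T, t ≠ 0 ∧ IsTorusElement H V h t u})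

/-- `G(ℂ((z)))`. -/
def loopGroup : Subgroup (LoopGL V) := chevalley H V Set.univ

/-- The group of germs of meromorphic `G`-valued functions, given by their Laurent expansions:
the Chevalley group over the field of convergent Laurent series. -/
def meroGroup : Subgroup (LoopGL V) := chevalley H V convergent

/-- `K = G(ℂ[[z]])`: the elements of `G(ℂ((z)))` which, together with their inverses, have
coefficients in `ℂ[[z]]`. -/
def taylorGroup : Subgroup (LoopGL V) :=
  loopGroup H V ⊓ MulAction.stabilizer (LoopGL V) (taylorLattice V : Set (LaurentModule V))

/-- The group of germs of holomorphic `G`-valued functions. -/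
def holoGroup : Subgroup (LoopGL V) :=
  meroGroup H V ⊓ MulAction.stabilizer (LoopGL V) (taylorLattice V : Set (LaurentModule V))

/-- Constants: `GL(V)` acting on `V((z))` coefficientwise. -/
def constGL : LinearMap.GeneralLinearGroup ℂ V →* LoopGL V :=
  Units.map (Module.End.baseChangeHom ℂ ℂ⸨X⸩ V).toMonoidHom

/-- `G(ℂ) ⊆ GL(V)`. -/
def constGroup : Subgroup (LinearMap.GeneralLinearGroup ℂ V) :=
  (chevalley H V (Set.range (algebraMap ℂ ℂ⸨X⸩))).comap (constGL V)

variable {H} in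
/-- The chamber `(L_V^*)_+` defined by the base `b`: those `h ∈ L_V^*` with `α(h) ∈ ℤ_{≥ 0}` for all
positive roots `α`. -/
def dominantChamber (b : (LieAlgebra.IsKilling.rootSystem H).Base) : Set H :=
  {h | h ∈ dualWeightLattice H V ∧
    ∀ i : H.root, b.IsPos i → ∃ n : ℕ, (i : LieModule.Weight ℂ H 𝔤) h = (n : ℂ)}

variable {H} in
/-- `χ` is the highest weight of `V` with respect to the base `b`: there is a nonzero vector of
weight `χ` that is killed by all root vectors of positive roots. -/
def IsHighestWeight (b : (LieAlgebra.IsKilling.rootSystem H).Base) (χ : H → ℂ) : Prop :=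
  ∃ v ∈ LieModule.weightSpace V χ, v ≠ 0 ∧
    ∀ i : H.root, b.IsPos i →
      ∀ x ∈ LieAlgebra.rootSpace H (i : LieModule.Weight ℂ H 𝔤), ⁅x, v⁆ = 0

variable {H}

/-! ### Flags -/

/-- The grading `V = ⨁ V_i`, `V_i = {v | h v = - i v}`. -/
def gradedPiece (h : H) (i : ℤ) : Submodule ℂ V :=
  (LieModule.toEnd ℂ 𝔤 V (h : 𝔤)).eigenspace (-(i : ℂ))

/-- The flag `F_j = ⨁_{s ≤ j} V_s`. -/
def flag (h : H) (j : ℤ) : Submodule ℂ V := ⨆ s : ℤ, ⨆ _ : s ≤ j, gradedPiece V h s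

/-- The Laurent series `∑ f_j z^j` with `f_j ∈ F_j` for all `j`. -/
def flagLattice (h : H) : Submodule ℂ (LaurentModule V) :=
  ⨅ j : ℤ, (flag V h j).comap (vcoeff j)

/-- `G_γ`: the stabilizer in `G(ℂ((z)))` of the flag determined by `h`. -/
def flagStabilizer (h : H) : Subgroup (LoopGL V) :=
  loopGroup H V ⊓ MulAction.stabilizer (LoopGL V) (flagLattice V h : Set (LaurentModule V))

/-- `K_γ = K ∩ G_γ` as a subgroup of `K`. -/
def taylorFlagStabilizer (h : H) : Subgroup (taylorGroup H V) :=
  (flagStabilizer V h).subgroupOf (taylorGroup H V)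

/-- `K_0 = ∏ K_γ ⊆ ∏ K`. -/
def K₀ {ι : Type*} (h : ι → H) : Subgroup (ι → taylorGroup H V) :=
  Subgroup.pi Set.univ fun γ => taylorFlagStabilizer V (h γ)

end Chevalley

/-! ### Matrix divisors on a Riemann surface -/

/-- A choice of a holomorphic local coordinate, vanishing at `x`, for every point `x`. -/
structure LocalCoordinates (S : Type*) [TopologicalSpace S] [ChartedSpace ℂ S] where
  chart : S → OpenPartialHomeomorph S ℂ
  mem_atlas : ∀ x, chart x ∈ IsManifold.maximalAtlas 𝓘(ℂ) ω S
  mem_source : ∀ x, x ∈ (chart x).source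
  centered : ∀ x, chart x x = 0

/-- `s ∈ V((z))` is the Laurent expansion at `x` of the `V`-valued function `f`, in the given
coordinate `z` at `x`. -/
def HasLaurentExpansion {S : Type*} [TopologicalSpace S] [ChartedSpace ℂ S]
    {V : Type*} [AddCommGroup V] [Module ℂ V]
    (c : LocalCoordinates S) (f : S → V) (x : S) (s : LaurentModule V) : Prop :=
  ∀ᶠ y in 𝓝[≠] x, ∀ φ : Module.Dual ℂ V,
    HasSum (fun n : ℤ => c.chart x y ^ n * φ (vcoeff n s)) (φ (f y))

/-- `f` is holomorphic on `U ∖ Γ`, has at most poles at the points of `U ∩ Γ`, and its Laurent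
expansion at each `γ ∈ U ∩ Γ` belongs to `L γ`. The values of `f` off `U ∖ Γ` are irrelevant. -/
def IsLocalSection {S : Type*} [TopologicalSpace S] [ChartedSpace ℂ S]
    {V : Type*} [AddCommGroup V] [Module ℂ V]
    (c : LocalCoordinates S) (Γ : Finset S) (L : Γ → Set (LaurentModule V))
    (U : TopologicalSpace.Opens S) (f : S → V) : Prop :=
  (∀ φ : Module.Dual ℂ V, MDifferentiableOn 𝓘(ℂ) 𝓘(ℂ) (fun y => φ (f y)) ((U : Set S) \ Γ)) ∧
    ∀ γ : Γ, (γ : S) ∈ U → ∃ s ∈ L γ, HasLaurentExpansion c f γ s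

section Divisors

variable {𝔤 : Type*} [LieRing 𝔤] [LieAlgebra ℂ 𝔤] [FiniteDimensional ℂ 𝔤]
  [LieAlgebra.IsSemisimple ℂ 𝔤]
  (H : LieSubalgebra ℂ 𝔤) [H.IsCartanSubalgebra]
  (V : Type*) [AddCommGroup V] [Module ℂ V] [LieRingModule 𝔤 V] [LieModule ℂ 𝔤 V]
  [FiniteDimensional ℂ V]
  {S : Type*} (Γ : Finset S)

/-- A distribution with support `Γ`: a germ of a meromorphic `G`-valued function at every point
`x`, written in the local coordinate at `x`, which is holomorphic for `x ∉ Γ`. -/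
@[ext]
structure GermDistribution where
  germ : S → LoopGL V
  mem_mero : ∀ x, germ x ∈ meroGroup H V
  mem_holo : ∀ x, x ∉ Γ → germ x ∈ holoGroup H V

variable {H V Γ}

/-- `A` and `B` are equivalent if `C A = B` for a distribution `C` holomorphic everywhere. -/
def GermDistribution.Equivalent (A B : GermDistribution H V Γ) : Prop :=
  ∃ C : S → LoopGL V, (∀ x, C x ∈ holoGroup H V) ∧ ∀ x, C x * A.germ x = B.germ x

variable (H V Γ) in
/-- Equivalence of distributions as a setoid. -/
def GermDistribution.setoid : Setoid (GermDistribution H V Γ) where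
  r := GermDistribution.Equivalent
  iseqv :=
    { refl := fun _ => ⟨fun _ => 1, fun _ => one_mem _, fun _ => one_mul _⟩
      symm := fun ⟨C, hC, h⟩ =>
        ⟨fun x => (C x)⁻¹, fun x => inv_mem (hC x), fun x => by rw [← h x, inv_mul_cancel_left]⟩
      trans := fun ⟨C, hC, h⟩ ⟨D, hD, k⟩ =>
        ⟨fun x => D x * C x, fun x => mul_mem (hD x) (hC x),
          fun x => by rw [mul_assoc, h x, k x]⟩ }

variable (H V Γ) in
/-- A matrix divisor is an equivalence class of distributions. -/
def MatrixDivisor : Type _ := Quotient (GermDistribution.setoid H V Γ)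

/-- The class of a distribution. -/
def GermDistribution.toDivisor (Ψ : GermDistribution H V Γ) : MatrixDivisor H V Γ :=
  Quotient.mk (GermDistribution.setoid H V Γ) Ψ

/-- The expansions `s` at `γ` for which `Ψ_γ s` is holomorphic. -/
def GermDistribution.stalk (Ψ : GermDistribution H V Γ) (γ : Γ) : Set (LaurentModule V) :=
  {s | Ψ.germ γ • s ∈ taylorLattice V}

theorem GermDistribution.Equivalent.stalk_eq {A B : GermDistribution H V Γ} (h : A.Equivalent B) :
    A.stalk = B.stalk := by
  obtain ⟨C, hC, hAB⟩ := h
  funext γ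
  ext s
  have h2 : C γ • (taylorLattice V : Set (LaurentModule V)) = taylorLattice V := (hC γ).2
  change A.germ γ • s ∈ (taylorLattice V : Set (LaurentModule V)) ↔
    B.germ γ • s ∈ (taylorLattice V : Set (LaurentModule V))
  rw [← hAB γ, mul_smul]
  conv_rhs => rw [← h2]
  exact Set.smul_mem_smul_set_iff.symm

/-- `stalk` depends on the matrix divisor only. -/
def MatrixDivisor.stalk (D : MatrixDivisor H V Γ) : Γ → Set (LaurentModule V) :=
  Quotient.lift GermDistribution.stalk (fun _ _ h => GermDistribution.Equivalent.stalk_eq h) D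

/-- The sheaf of sections of a matrix divisor: `f` is a meromorphic `V`-valued function on `U`,
holomorphic on `U ∖ Γ`, such that `Ψ_γ f` is holomorphic near each `γ ∈ U ∩ Γ`. -/
def MatrixDivisor.IsSection [TopologicalSpace S] [ChartedSpace ℂ S] (c : LocalCoordinates S)
    (D : MatrixDivisor H V Γ) (U : TopologicalSpace.Opens S) (f : S → V) : Prop :=
  IsLocalSection c Γ D.stalk U f

/-- `Ψ` has toric invariants `h`: at each `γ ∈ Γ`, the Cartan decomposition of `Ψ_γ` has the form
`k z^{h_γ} k'`. -/
def GermDistribution.HasInvariants (Ψ : GermDistribution H V Γ) (h : Γ → H) : Prop :=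
  ∀ γ : Γ, ∃ k ∈ holoGroup H V, ∃ k' ∈ holoGroup H V, ∃ u : LoopGL V,
    IsTorusElement H V (h γ) zSeries u ∧ Ψ.germ γ = k * u * k'

theorem GermDistribution.Equivalent.hasInvariants {A B : GermDistribution H V Γ} (hAB : A.Equivalent B)
    {h : Γ → H} (hA : A.HasInvariants h) : B.HasInvariants h := by
  obtain ⟨C, hC, hCAB⟩ := hAB
  intro γ
  obtain ⟨k, hk, k', hk', u, hu, e⟩ := hA γ
  exact ⟨C γ * k, mul_mem (hC γ) hk, k', hk', u, hu, by rw [← hCAB γ, e]; simp only [mul_assoc]⟩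

/-- `HasInvariants` depends on the matrix divisor only. -/
def MatrixDivisor.HasInvariants (h : Γ → H) (D : MatrixDivisor H V Γ) : Prop :=
  Quotient.lift (fun Ψ : GermDistribution H V Γ => Ψ.HasInvariants h)
    (fun _ _ hAB => propext ⟨GermDistribution.Equivalent.hasInvariants hAB,
      GermDistribution.Equivalent.hasInvariants ((GermDistribution.setoid H V Γ).symm hAB)⟩) D

variable [TopologicalSpace S] [ChartedSpace ℂ S]

variable (V) in
/-- Matrix divisors with invariants `h`, identified when they have the same sheaf of sections. -/
def moduliSetoid (c : LocalCoordinates S) (h : Γ → H) :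
    Setoid {D : MatrixDivisor H V Γ // D.HasInvariants h} where
  r D D' := ∀ U f, D.1.IsSection c U f ↔ D'.1.IsSection c U f
  iseqv :=
    { refl := fun _ _ _ => Iff.rfl
      symm := fun h U f => (h U f).symm
      trans := fun h k U f => (h U f).trans (k U f) }

variable (V) in
/-- The moduli space of matrix divisors with invariants `h` and fixed support `Γ`. -/
def ModuliSpace (c : LocalCoordinates S) (h : Γ → H) : Type _ := Quotient (moduliSetoid V c h)

/-- The sections of a point of the moduli space. -/
def ModuliSpace.IsSection {c : LocalCoordinates S} {h : Γ → H} (m : ModuliSpace V c h)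
    (U : TopologicalSpace.Opens S) (f : S → V) : Prop :=
  Quotient.lift (fun D : {D : MatrixDivisor H V Γ // D.HasInvariants h} => D.1.IsSection c U f)
    (fun D D' (hD : ∀ U f, D.1.IsSection c U f ↔ D'.1.IsSection c U f) => propext (hD U f)) m

/-- The point of the moduli space defined by a distribution with invariants `h`. -/
def GermDistribution.toModuli (c : LocalCoordinates S) {h : Γ → H} (Ψ : GermDistribution H V Γ)
    (hΨ : Ψ.HasInvariants h) : ModuliSpace V c h :=
  Quotient.mk (moduliSetoid V c h) ⟨Ψ.toDivisor, hΨ⟩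

/-- The sheaf of sections of `m'` is the left shift by the constant `g ∈ G(ℂ)` of that of `m`. -/
def ModuliSpace.IsShift {c : LocalCoordinates S} {h : Γ → H} (g : LinearMap.GeneralLinearGroup ℂ V)
    (m m' : ModuliSpace V c h) : Prop :=
  ∀ U f, m.IsSection U f ↔ m'.IsSection U fun y => g • f y

end Divisors

end MatrixDivisors

end

/-!
A point of the moduli space is determined by the lattices `Ψ_γ⁻¹ V[[z]]`, `γ ∈ Γ`: every vector of
`V((z))` agrees to any prescribed order with a Laurent polynomial, and Laurent polynomials in the
local coordinate are local sections, so the sheaf of sections determines its stalks. The lattice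
attached to the flag of `h` is `F_h = z^(-h) V[[z]]`; hence for `Ψ_γ = k z^(h_γ) k'` the stalk at
`γ` is `k'⁻¹ F_(h_γ)`, a translate of `F_(h_γ)` under `K`.

Conversely every translate under `K` occurs. The root elements and the torus elements with
convergent parameter are `z`-adically dense in those with formal parameter, so each `k ∈ K` is a
product of a convergent loop and a loop congruent to `1` modulo a high power of `z`, and the latter
does not change the lattice. The moduli space is thus the `K^Γ`-orbit of `(F_(h_γ))_γ`, whose
stabilizer is `K_0`.
-/

noncomputable section

namespace MatrixDivisors

/-! ### The `z`-adic filtration -/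

section Filtration

variable {V : Type*} [AddCommGroup V] [Module ℂ V]

@[simp]
theorem vcoeff_tmul (n : ℤ) (a : ℂ⸨X⸩) (v : V) : vcoeff n (a ⊗ₜ[ℂ] v) = a.coeff n • v := by
  simp [vcoeff]

/-- The Laurent series `∑ φ(s_n) z^n` obtained by applying a linear form `φ` to the coefficients of
`s = ∑ s_n z^n`. -/
def component (φ : Module.Dual ℂ V) : LaurentModule V →ₗ[ℂ⸨X⸩] ℂ⸨X⸩ :=
  (TensorProduct.AlgebraTensorModule.rid ℂ ℂ⸨X⸩ ℂ⸨X⸩).toLinearMap ∘ₗ LinearMap.baseChange ℂ⸨X⸩ φ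

@[simp]
theorem component_tmul (φ : Module.Dual ℂ V) (a : ℂ⸨X⸩) (v : V) :
    component φ (a ⊗ₜ[ℂ] v) = φ v • a := by
  simp [component]

@[simp]
theorem coeff_component (φ : Module.Dual ℂ V) (s : LaurentModule V) (n : ℤ) :
    (component φ s).coeff n = φ (vcoeff n s) := by
  induction s using TensorProduct.induction_on with
  | zero => simp
  | tmul a v => simp [mul_comm]
  | add x y hx hy => simp [hx, hy]

theorem basis_repr_eq_component {ι : Type*} (b : Module.Basis ι ℂ V) (s : LaurentModule V) (i : ι) :
    (Algebra.TensorProduct.basis ℂ⸨X⸩ b).repr s i = component (b.coord i) s := by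
  induction s using TensorProduct.induction_on with
  | zero => simp
  | tmul a v => simp [mul_comm a, ← Algebra.smul_def]
  | add x y hx hy => simp [hx, hy]

theorem ext_vcoeff {s t : LaurentModule V} (h : ∀ n, vcoeff n s = vcoeff n t) : s = t := by
  let b := Module.Basis.ofVectorSpace ℂ V
  refine (Algebra.TensorProduct.basis ℂ⸨X⸩ b).ext_elem fun i => ?_
  ext n
  rw [basis_repr_eq_component, basis_repr_eq_component, coeff_component, coeff_component, h]

theorem vcoeff_single_smul (k n : ℤ) (s : LaurentModule V) :
    vcoeff n ((HahnSeries.single k (1 : ℂ) : ℂ⸨X⸩) • s) = vcoeff (n - k) s := by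
  rw [← sub_eq_zero, ← Module.forall_dual_apply_eq_zero_iff ℂ]
  intro φ
  rw [map_sub, ← coeff_component, ← coeff_component, map_smul, smul_eq_mul,
    HahnSeries.coeff_single_mul, one_mul, sub_self]

variable (V) in
/-- The lattice `z^N V[[z]]`. -/
def filtration (N : ℤ) : Submodule ℂ (LaurentModule V) where
  carrier := {s | ∀ n < N, vcoeff n s = 0}
  add_mem' ha hb n hn := by rw [map_add, ha n hn, hb n hn, add_zero]
  zero_mem' n _ := map_zero _
  smul_mem' c x hx n hn := by rw [map_smul, hx n hn, smul_zero]

theorem filtration_antitone : Antitone (filtration V) :=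
  fun _ _ h _ hs n hn => hs n (hn.trans_le h)

theorem mem_filtration_iff_component {N : ℤ} {s : LaurentModule V} :
    s ∈ filtration V N ↔ ∀ φ, (N : WithTop ℤ) ≤ (component φ s).orderTop := by
  simp only [HahnSeries.le_orderTop_iff_forall, coeff_component, WithTop.coe_lt_coe]
  rw [forall_comm]
  refine forall_congr' fun n => ?_
  rw [forall_comm]
  exact forall_congr' fun _ => (Module.forall_dual_apply_eq_zero_iff ℂ _).symm

theorem tmul_mem_filtration {N : ℤ} {a : ℂ⸨X⸩} (ha : (N : WithTop ℤ) ≤ a.orderTop) (v : V) :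
    a ⊗ₜ[ℂ] v ∈ filtration V N := fun n hn => by
  rw [vcoeff_tmul, HahnSeries.coeff_eq_zero_of_lt_orderTop ((WithTop.coe_lt_coe.2 hn).trans_le ha),
    zero_smul]

theorem smul_mem_filtration {M N : ℤ} {a : ℂ⸨X⸩} (ha : (M : WithTop ℤ) ≤ a.orderTop)
    {s : LaurentModule V} (hs : s ∈ filtration V N) : a • s ∈ filtration V (M + N) := by
  rw [mem_filtration_iff_component] at hs ⊢
  intro φ
  rw [map_smul, smul_eq_mul, WithTop.coe_add]
  exact (add_le_add ha (hs φ)).trans HahnSeries.orderTop_add_le_mul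

theorem exists_le_orderTop (a : ℂ⸨X⸩) : ∃ N : ℤ, (N : WithTop ℤ) ≤ a.orderTop := by
  rcases eq_or_ne a 0 with rfl | ha
  · exact ⟨0, by simp⟩
  · exact ⟨a.order, (HahnSeries.order_eq_orderTop_of_ne_zero ha).le⟩

theorem exists_mem_filtration (s : LaurentModule V) : ∃ N : ℤ, s ∈ filtration V N := by
  induction s using TensorProduct.induction_on with
  | zero => exact ⟨0, zero_mem _⟩
  | tmul a v =>
    obtain ⟨N, hN⟩ := exists_le_orderTop a
    exact ⟨N, tmul_mem_filtration hN v⟩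
  | add x y hx hy =>
    obtain ⟨M, hM⟩ := hx
    obtain ⟨N, hN⟩ := hy
    exact ⟨min M N, add_mem (filtration_antitone (min_le_left M N) hM)
      (filtration_antitone (min_le_right M N) hN)⟩

variable (V) in
/-- The algebra of endomorphisms of the `ℂ((z))`-vector space `V((z))`. -/
abbrev LoopEnd : Type _ := Module.End ℂ⸨X⸩ (LaurentModule V)

-- Instance search misses this: it does not recover the additive group structure of the tensor
-- product by unification.
instance : Ring (LoopEnd V) :=
  @Module.End.instRing ℂ⸨X⸩ (LaurentModule V) _ TensorProduct.addCommGroup TensorProduct.leftModule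

variable (V) in
/-- The endomorphisms of `V((z))` of `z`-adic order at least `N`: they map `z^M V[[z]]` to
`z^(M+N) V[[z]]` for every `M`. -/
def filteredEnd (N : ℤ) : AddSubgroup (LoopEnd V) where
  carrier := {A | ∀ M, ∀ s ∈ filtration V M, A s ∈ filtration V (M + N)}
  zero_mem' _ _ _ := zero_mem _
  add_mem' hA hB M s hs := add_mem (hA M s hs) (hB M s hs)
  neg_mem' hA M s hs n hn := (map_neg (vcoeff n) _).trans (neg_eq_zero.2 (hA M s hs n hn))

theorem filteredEnd_antitone : Antitone (filteredEnd V) :=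
  fun _ _ h _ hA M s hs => filtration_antitone (by lia) (hA M s hs)

theorem mul_mem_filteredEnd {M N : ℤ} {A B : LoopEnd V} (hA : A ∈ filteredEnd V M)
    (hB : B ∈ filteredEnd V N) : A * B ∈ filteredEnd V (M + N) := fun k s hs => by
  rw [add_comm M, ← add_assoc]
  exact hA _ _ (hB k s hs)

theorem vcoeff_baseChange (f : Module.End ℂ V) (n : ℤ) (s : LaurentModule V) :
    vcoeff n (LinearMap.baseChange ℂ⸨X⸩ f s) = f (vcoeff n s) := by
  induction s using TensorProduct.induction_on with
  | zero => simp
  | tmul a v => simp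
  | add x y hx hy => simp only [map_add, hx, hy]

theorem smul_baseChange_mem_filteredEnd {N : ℤ} {a : ℂ⸨X⸩} (ha : (N : WithTop ℤ) ≤ a.orderTop)
    (f : Module.End ℂ V) : a • LinearMap.baseChange ℂ⸨X⸩ f ∈ filteredEnd V N := fun M s hs => by
  rw [add_comm]
  refine smul_mem_filtration ha fun n hn => ?_
  rw [vcoeff_baseChange, hs n hn, map_zero]

theorem exists_mem_filteredEnd [FiniteDimensional ℂ V] (A : LoopEnd V) :
    ∃ N : ℤ, A ∈ filteredEnd V N := by
  let b := Module.finBasis ℂ V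
  choose N hN using fun i => exists_mem_filtration (A (1 ⊗ₜ[ℂ] b i))
  obtain ⟨K, hK⟩ := (Set.finite_range N).bddBelow
  refine ⟨K, fun M s hs => ?_⟩
  rw [← (Algebra.TensorProduct.basis ℂ⸨X⸩ b).sum_repr s, map_sum]
  refine sum_mem fun i _ => ?_
  rw [map_smul, basis_repr_eq_component, Algebra.TensorProduct.basis_apply]
  exact smul_mem_filtration (mem_filtration_iff_component.1 hs _)
    (filtration_antitone (hK ⟨i, rfl⟩) (hN i))

end Filtration

/-! ### Congruence subgroups and `z`-adic closures -/

section Congruence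

/-- The congruence subgroup of `Rˣ` defined by a (non-unital) subring `I`: the units `u` such that
`u` and `u⁻¹` are congruent to `1` modulo `I`. -/
def congruenceUnits {R : Type*} [Ring R] (I : NonUnitalSubring R) : Subgroup Rˣ where
  carrier := {u | (u : R) - 1 ∈ I ∧ ((u⁻¹ : Rˣ) : R) - 1 ∈ I}
  one_mem' := by simp
  inv_mem' h := ⟨h.2, by simpa using h.1⟩
  mul_mem' {u v} hu hv := by
    have mul_sub_one_mem {a b : R} (ha : a - 1 ∈ I) (hb : b - 1 ∈ I) : a * b - 1 ∈ I := by
      rw [show a * b - 1 = (a - 1) * (b - 1) + ((a - 1) + (b - 1)) by noncomm_ring]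
      exact add_mem (mul_mem ha hb) (add_mem ha hb)
    exact ⟨mul_sub_one_mem hu.1 hv.1, by
      rw [mul_inv_rev]; exact mul_sub_one_mem hv.2 hu.2⟩

variable (V : Type*) [AddCommGroup V] [Module ℂ V]

/-- The endomorphisms of `V((z))` that vanish modulo `z^N`, as a non-unital ring. -/
def filteredEndSubring (N : ℕ) : NonUnitalSubring (LoopEnd V) where
  __ := filteredEnd V N
  mul_mem' hA hB := filteredEnd_antitone (by lia) (mul_mem_filteredEnd hA hB)

/-- The automorphisms of `V((z))` that are congruent to `1` modulo `z^N`. -/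
def congruence (N : ℕ) : Subgroup (LoopGL V) := congruenceUnits (filteredEndSubring V N)

variable {V}

theorem congruence_le_stabilizer (N : ℕ) : congruence V N ≤
    MulAction.stabilizer (LoopGL V) (taylorLattice V : Set (LaurentModule V)) := by
  intro g hg
  have apply_mem {g : LoopGL V} (hg : (g : LoopEnd V) - 1 ∈ filteredEnd V N)
      {s : LaurentModule V} (hs : s ∈ filtration V 0) : g • s ∈ filtration V 0 := by
    rw [← sub_add_cancel (g • s) s]
    exact add_mem (filtration_antitone (by lia) (hg 0 s hs)) hs
  exact MulAction.mem_stabilizer_set.2 fun s =>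
    ⟨fun hs => by rw [← inv_smul_smul g s]; exact apply_mem hg.2 hs, apply_mem hg.1⟩

theorem exists_conj_mem_congruence [FiniteDimensional ℂ V] (a : LoopGL V) (N : ℕ) :
    ∃ M : ℕ, ∀ g ∈ congruence V M, a * g * a⁻¹ ∈ congruence V N := by
  obtain ⟨p, hp⟩ := exists_mem_filteredEnd (a : LoopEnd V)
  obtain ⟨q, hq⟩ := exists_mem_filteredEnd ((a⁻¹ : LoopGL V) : LoopEnd V)
  have conj_mem (g : LoopGL V)
      (hg : (g : LoopEnd V) - 1 ∈ filteredEnd V (N + p.natAbs + q.natAbs : ℕ)) :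
      ((a * g * a⁻¹ : LoopGL V) : LoopEnd V) - 1 ∈ filteredEnd V N := by
    have h : ((a * g * a⁻¹ : LoopGL V) : LoopEnd V) - 1 = a * (g - 1) * (a⁻¹ : LoopGL V) := by
      rw [mul_sub, sub_mul, mul_one, Units.mul_inv, Units.val_mul, Units.val_mul]
    rw [h]
    exact filteredEnd_antitone (by lia) (mul_mem_filteredEnd (mul_mem_filteredEnd hp hg) hq)
  refine ⟨N + p.natAbs + q.natAbs, fun g hg => ⟨conj_mem g hg.1, ?_⟩⟩
  rw [conj_inv]
  exact conj_mem g⁻¹ hg.2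

/-- The closure of a subgroup in the `z`-adic topology of `GL(V((z)))`. -/
def adicClosure [FiniteDimensional ℂ V] (P : Subgroup (LoopGL V)) : Subgroup (LoopGL V) where
  carrier := {g | ∀ N : ℕ, ∃ p ∈ P, p⁻¹ * g ∈ congruence V N}
  one_mem' N := ⟨1, one_mem _, by simp⟩
  mul_mem' := by
    intro a b ha hb N
    obtain ⟨q, hq, hqb⟩ := hb N
    obtain ⟨M, hM⟩ := exists_conj_mem_congruence q⁻¹ N
    obtain ⟨p, hp, hpa⟩ := ha M
    refine ⟨p * q, mul_mem hp hq, ?_⟩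
    rw [show (p * q)⁻¹ * (a * b) = q⁻¹ * (p⁻¹ * a) * q⁻¹⁻¹ * (q⁻¹ * b) by group]
    exact mul_mem (hM _ hpa) hqb
  inv_mem' := by
    intro a ha N
    obtain ⟨M, hM⟩ := exists_conj_mem_congruence a N
    obtain ⟨p, hp, hpa⟩ := ha M
    refine ⟨p⁻¹, inv_mem hp, ?_⟩
    rw [show p⁻¹⁻¹ * a⁻¹ = a * (p⁻¹ * a)⁻¹ * a⁻¹ by group]
    exact hM _ (inv_mem hpa)

end Congruence

/-! ### Approximation of scalars by convergent series -/

section Scalars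

theorem zSeries_zpow (n : ℤ) : zSeries ^ n = HahnSeries.single n (1 : ℂ) := by
  have pow_eq (k : ℕ) : zSeries ^ k = HahnSeries.single (k : ℤ) (1 : ℂ) := by
    simp [zSeries, HahnSeries.single_pow]
  obtain ⟨k, rfl | rfl⟩ := n.eq_nat_or_neg
  · rw [zpow_natCast, pow_eq]
  · rw [zpow_neg, zpow_natCast, pow_eq]
    exact inv_eq_of_mul_eq_one_right (by simp)

theorem mem_convergent_of_coeff_eq_zero {a : ℂ⸨X⸩} {N : ℤ} (h : ∀ n ≥ N, a.coeff n = 0) :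
    a ∈ convergent := by
  refine ⟨1, one_pos, summable_of_ne_finset_zero (s := Finset.range N.toNat) fun n hn => ?_⟩
  rw [h n (by simpa using hn), norm_zero, zero_mul]

theorem exists_convergent_le_orderTop_sub (a : ℂ⸨X⸩) (N : ℤ) :
    ∃ c ∈ convergent, (N : WithTop ℤ) ≤ (a - c).orderTop := by
  refine ⟨HahnSeries.truncLT N a, mem_convergent_of_coeff_eq_zero (N := N) fun n hn =>
    HahnSeries.coeff_truncLT_of_le hn a, HahnSeries.le_orderTop_iff_forall.2 fun n hn => ?_⟩
  rw [HahnSeries.coeff_sub, HahnSeries.coeff_truncLT_of_lt (WithTop.coe_lt_coe.1 hn), sub_self]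

/-- The ideal `z^N ℂ[[z]]` of `ℂ[[z]]`, as a non-unital ring. -/
def adicIdeal (N : ℕ) : NonUnitalSubring ℂ⸨X⸩ where
  carrier := {a | ((N : ℤ) : WithTop ℤ) ≤ a.orderTop}
  zero_mem' := by simp
  add_mem' {a b} ha hb := (le_min ha hb).trans (HahnSeries.min_orderTop_le_orderTop_add (x := a))
  neg_mem' {a} ha := le_of_le_of_eq ha (HahnSeries.orderTop_neg (x := a)).symm
  mul_mem' ha hb := by
    refine le_trans ?_ ((add_le_add ha hb).trans HahnSeries.orderTop_add_le_mul)
    exact_mod_cast Nat.le_add_right N N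

theorem mem_adicIdeal {N : ℕ} {a : ℂ⸨X⸩} :
    a ∈ adicIdeal N ↔ ((N : ℤ) : WithTop ℤ) ≤ a.orderTop := Iff.rfl

theorem inv_mul_mem_adicIdeal {N : ℕ} {c : (ℂ⸨X⸩)ˣ} {d : ℂ⸨X⸩}
    (h : (c : ℂ⸨X⸩).orderTop + (N : ℤ) ≤ d.orderTop) :
    ((c⁻¹ : (ℂ⸨X⸩)ˣ) : ℂ⸨X⸩) * d ∈ adicIdeal N := by
  have hc : (c : ℂ⸨X⸩).orderTop ≠ ⊤ := HahnSeries.orderTop_ne_top.2 c.ne_zero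
  rwa [mem_adicIdeal, ← WithTop.add_le_add_iff_left hc, ← HahnSeries.orderTop_mul,
    Units.mul_inv_cancel_left]

theorem exists_convergent_inv_mul_mem (a : (ℂ⸨X⸩)ˣ) (N : ℕ) :
    ∃ c : (ℂ⸨X⸩)ˣ, (c : ℂ⸨X⸩) ∈ convergent ∧ c⁻¹ * a ∈ congruenceUnits (adicIdeal N) := by
  have order_eq := HahnSeries.order_eq_orderTop_of_ne_zero a.ne_zero
  obtain ⟨c, hc, hac⟩ :=
    exists_convergent_le_orderTop_sub (a : ℂ⸨X⸩) ((a : ℂ⸨X⸩).order + (N + 1))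
  have hac' : (a : ℂ⸨X⸩).orderTop + (N : ℤ) ≤ (a - c).orderTop := by
    refine le_trans ?_ hac
    rw [← order_eq]
    exact_mod_cast (by lia)
  have orderTop_eq : c.orderTop = (a : ℂ⸨X⸩).orderTop := by
    rw [← sub_sub_cancel (a : ℂ⸨X⸩) c]
    refine HahnSeries.orderTop_sub (lt_of_lt_of_le ?_ hac)
    rw [← order_eq]
    exact_mod_cast (by lia)
  have hc0 : c ≠ 0 := by
    rw [← HahnSeries.orderTop_ne_top, orderTop_eq]
    exact HahnSeries.orderTop_ne_top.2 a.ne_zero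
  refine ⟨Units.mk0 c hc0, hc, ?_, ?_⟩
  · have h : (((Units.mk0 c hc0)⁻¹ * a : (ℂ⸨X⸩)ˣ) : ℂ⸨X⸩) - 1
        = ((Units.mk0 c hc0)⁻¹ : (ℂ⸨X⸩)ˣ) * (a - c) := by
      rw [mul_sub, Units.val_mul]
      simp [hc0]
    rw [h]
    exact inv_mul_mem_adicIdeal (orderTop_eq ▸ hac')
  · have h : (((Units.mk0 c hc0)⁻¹ * a : (ℂ⸨X⸩)ˣ)⁻¹ : (ℂ⸨X⸩)ˣ) - (1 : ℂ⸨X⸩)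
        = -((a⁻¹ : (ℂ⸨X⸩)ˣ) * (a - c)) := by
      rw [mul_sub, Units.inv_mul, mul_inv_rev, inv_inv]
      simp
    rw [h]
    exact neg_mem (inv_mul_mem_adicIdeal hac')

end Scalars

/-! ### Root elements -/

section Exp

variable {𝔤 : Type*} [LieRing 𝔤] [LieAlgebra ℂ 𝔤]
  {V : Type*} [AddCommGroup V] [Module ℂ V] [LieRingModule 𝔤 V] [LieModule ℂ 𝔤 V] {x : 𝔤}

theorem expEnd_eq_sum {k : ℕ} (hk : LieModule.toEnd ℂ 𝔤 V x ^ k = 0) (t : ℂ⸨X⸩) :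
    expEnd V x t = ∑ n ∈ Finset.range k, (algebraMap ℂ ℂ⸨X⸩ ((n.factorial : ℂ)⁻¹) * t ^ n) •
      LinearMap.baseChange ℂ⸨X⸩ (LieModule.toEnd ℂ 𝔤 V x ^ n) := by
  refine Finset.sum_subset (Finset.range_mono (Nat.sInf_le hk)) fun n _ hn => ?_
  rw [pow_eq_zero_of_le (by simpa using hn) (pow_nilpotencyClass ⟨k, hk⟩),
    LinearMap.baseChange_zero]
  exact smul_zero (A := LoopEnd V) (_ : ℂ⸨X⸩)

theorem smul_baseChange_pow (f : Module.End ℂ V) (t : ℂ⸨X⸩) (n : ℕ) :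
    (t • LinearMap.baseChange ℂ⸨X⸩ f : LoopEnd V) ^ n
      = t ^ n • LinearMap.baseChange ℂ⸨X⸩ (f ^ n) := by
  rw [LinearMap.baseChange_pow]
  exact smul_pow t (LinearMap.baseChange ℂ⸨X⸩ f : LoopEnd V) n

theorem smul_baseChange_pow_eq_zero {f : Module.End ℂ V} {k : ℕ} (hk : f ^ k = 0) (t : ℂ⸨X⸩) :
    (t • LinearMap.baseChange ℂ⸨X⸩ f : LoopEnd V) ^ k = 0 := by
  rw [smul_baseChange_pow, hk, LinearMap.baseChange_zero, smul_zero (A := LoopEnd V) (t ^ k)]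

theorem isNilpotent_smul_baseChange {f : Module.End ℂ V} (hf : IsNilpotent f) (t : ℂ⸨X⸩) :
    IsNilpotent (t • LinearMap.baseChange ℂ⸨X⸩ f : LoopEnd V) :=
  hf.imp fun _ hk => smul_baseChange_pow_eq_zero hk t

theorem expEnd_eq_exp (hx : IsNilpotent (LieModule.toEnd ℂ 𝔤 V x)) (t : ℂ⸨X⸩) :
    expEnd V x t = IsNilpotent.exp
      (t • LinearMap.baseChange ℂ⸨X⸩ (LieModule.toEnd ℂ 𝔤 V x) : LoopEnd V) := by
  obtain ⟨k, hk⟩ := hx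
  rw [expEnd_eq_sum hk, IsNilpotent.exp_eq_sum (smul_baseChange_pow_eq_zero hk t)]
  refine Finset.sum_congr rfl fun n _ => ?_
  let A : LoopEnd V := LinearMap.baseChange ℂ⸨X⸩ (LieModule.toEnd ℂ 𝔤 V x ^ n)
  rw [smul_baseChange_pow, inv_natCast_smul_eq ℚ ℂ⸨X⸩ n.factorial (t ^ n • A), map_inv₀,
    map_natCast]
  exact mul_smul (n.factorial : ℂ⸨X⸩)⁻¹ (t ^ n) A

theorem expEnd_add (hx : IsNilpotent (LieModule.toEnd ℂ 𝔤 V x)) (s t : ℂ⸨X⸩) :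
    expEnd V x (s + t) = expEnd V x s * expEnd V x t := by
  let A : LoopEnd V := LinearMap.baseChange ℂ⸨X⸩ (LieModule.toEnd ℂ 𝔤 V x)
  rw [expEnd_eq_exp hx, expEnd_eq_exp hx, expEnd_eq_exp hx, add_smul s t A]
  exact IsNilpotent.exp_add_of_commute (((Commute.refl A).smul_left s).smul_right t)
      (isNilpotent_smul_baseChange hx s) (isNilpotent_smul_baseChange hx t)

theorem expEnd_zero (hx : IsNilpotent (LieModule.toEnd ℂ 𝔤 V x)) : expEnd V x 0 = 1 := by
  let A : LoopEnd V := LinearMap.baseChange ℂ⸨X⸩ (LieModule.toEnd ℂ 𝔤 V x)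
  rw [expEnd_eq_exp hx, zero_smul ℂ⸨X⸩ A, IsNilpotent.exp_zero]

theorem expEnd_sub_one_mem_filteredEnd (hx : IsNilpotent (LieModule.toEnd ℂ 𝔤 V x)) {N : ℕ}
    {t : ℂ⸨X⸩} (ht : t ∈ adicIdeal N) : expEnd V x t - 1 ∈ filteredEnd V N := by
  obtain ⟨k, hk⟩ := hx
  have pow_mem (n : ℕ) : t ^ (n + 1) ∈ adicIdeal N := by
    induction n with
    | zero => simpa using ht
    | succ n ih => exact pow_succ t (n + 1) ▸ mul_mem ih ht
  rw [expEnd_eq_sum (pow_eq_zero_of_le k.le_succ hk), Finset.sum_range_succ']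
  simp only [Nat.factorial_zero, Nat.cast_one, inv_one, map_one, pow_zero, mul_one]
  rw [LinearMap.baseChange_one, one_smul ℂ⸨X⸩ (1 : LoopEnd V),
    add_sub_cancel_right]
  refine sum_mem fun n _ => smul_baseChange_mem_filteredEnd ?_ _
  rw [← Algebra.smul_def]
  exact le_trans (mem_adicIdeal.1 (pow_mem n)) (HahnSeries.orderTop_le_orderTop_smul _ _)

/-- The root element `exp (t x)` of `GL(V((z)))`. -/
def expUnit (hx : IsNilpotent (LieModule.toEnd ℂ 𝔤 V x)) (t : ℂ⸨X⸩) : LoopGL V where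
  val := expEnd V x t
  inv := expEnd V x (-t)
  val_inv := by rw [← expEnd_add hx, add_neg_cancel, expEnd_zero hx]
  inv_val := by rw [← expEnd_add hx, neg_add_cancel, expEnd_zero hx]

theorem expUnit_inv_mul_mem_congruence (hx : IsNilpotent (LieModule.toEnd ℂ 𝔤 V x)) {N : ℕ}
    {s t : ℂ⸨X⸩} (hst : t - s ∈ adicIdeal N) :
    (expUnit hx s)⁻¹ * expUnit hx t ∈ congruence V N := by
  have h : (expUnit hx s)⁻¹ * expUnit hx t = expUnit hx (t - s) := Units.ext <| by
    rw [sub_eq_neg_add]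
    exact (expEnd_add hx (-s) t).symm
  rw [h]
  exact ⟨expEnd_sub_one_mem_filteredEnd hx hst, expEnd_sub_one_mem_filteredEnd hx (neg_mem hst)⟩

end Exp

/-! ### Weights -/

section Weights

variable {𝔤 : Type*} [LieRing 𝔤] [LieAlgebra ℂ 𝔤]
  {H : LieSubalgebra ℂ 𝔤} [H.IsCartanSubalgebra]
  {V : Type*} [AddCommGroup V] [Module ℂ V] [LieRingModule 𝔤 V] [LieModule ℂ 𝔤 V]

section Semisimple

variable [FiniteDimensional ℂ 𝔤] [LieAlgebra.IsSemisimple ℂ 𝔤]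

theorem lie_mem_weightSpace_add {α β : H → ℂ} {x : 𝔤} (hx : x ∈ LieAlgebra.rootSpace H α) {v : V}
    (hv : v ∈ LieModule.weightSpace V β) : ⁅x, v⁆ ∈ LieModule.weightSpace V (α + β) := by
  rw [LieModule.mem_weightSpace] at hv ⊢
  intro h
  have hx' : ⁅(h : 𝔤), x⁆ = α h • x := LieAlgebra.IsKilling.lie_eq_smul_of_mem_rootSpace hx h
  have hv' : ⁅(h : 𝔤), v⁆ = β h • v := hv h
  change ⁅(h : 𝔤), ⁅x, v⁆⁆ = _
  rw [leibniz_lie, hx', hv', smul_lie, lie_smul, Pi.add_apply, add_smul]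

theorem lie_mem_iSup_weightSpace (x : 𝔤) {w : V}
    (hw : w ∈ ⨆ μ : H → ℂ, (LieModule.weightSpace V μ).toSubmodule) :
    ⁅x, w⁆ ∈ ⨆ μ : H → ℂ, (LieModule.weightSpace V μ).toSubmodule := by
  have hx : x ∈ ⨆ α : H → ℂ, (LieAlgebra.rootSpace H α).toSubmodule := by
    rw [← LieSubmodule.iSup_toSubmodule, LieModule.iSup_genWeightSpace_eq_top ℂ H 𝔤]
    trivial
  induction hx using Submodule.iSup_induction' with
  | mem α x hx =>
    induction hw using Submodule.iSup_induction' with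
    | mem β w hw => exact Submodule.mem_iSup_of_mem (α + β) (lie_mem_weightSpace_add hx hw)
    | zero => simp
    | add a b _ _ ha hb => rw [lie_add]; exact add_mem ha hb
  | zero => simp
  | add a b _ _ ha hb => rw [add_lie]; exact add_mem ha hb

variable (H V) in
/-- The sum of the weight spaces of `V`, as a submodule over `𝔤`. -/
def weightSpaceSum : LieSubmodule ℂ 𝔤 V where
  __ := ⨆ μ : H → ℂ, (LieModule.weightSpace V μ).toSubmodule
  lie_mem hw := lie_mem_iSup_weightSpace _ hw

end Semisimple

variable (H V) in
/-- The module is the sum of its weight spaces. -/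
def IsWeightModule : Prop :=
  ⨆ μ : LieModule.Weight ℂ H V, (LieModule.weightSpace V (μ : H → ℂ)).toSubmodule = ⊤

theorem IsWeightModule.of_isIrreducible [FiniteDimensional ℂ 𝔤] [LieAlgebra.IsSemisimple ℂ 𝔤]
    [LieModule.IsIrreducible ℂ 𝔤 V] {χ : H → ℂ} {v : V} (hv : v ∈ LieModule.weightSpace V χ)
    (hv0 : v ≠ 0) : IsWeightModule H V := by
  have mem_sum : v ∈ weightSpaceSum H V :=
    Submodule.mem_iSup_of_mem (p := fun μ : H → ℂ => (LieModule.weightSpace V μ).toSubmodule) χ hv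
  have sum_eq_top : weightSpaceSum H V = ⊤ :=
    (eq_bot_or_eq_top _).resolve_left fun h => hv0 (by rwa [h, LieSubmodule.mem_bot] at mem_sum)
  refine eq_top_iff.2
    ((congrArg LieSubmodule.toSubmodule sum_eq_top).ge.trans (iSup_le fun μ => ?_))
  by_cases hμ : LieModule.genWeightSpace V μ = ⊥
  · have := LieModule.weightSpace_le_genWeightSpace V μ
    rw [hμ, le_bot_iff] at this
    rw [this]
    exact bot_le
  · exact le_iSup (fun μ : LieModule.Weight ℂ H V =>
      (LieModule.weightSpace V (μ : H → ℂ)).toSubmodule) ⟨μ, hμ⟩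

theorem IsWeightModule.linearMap_ext (hV : IsWeightModule H V) {W : Type*} [AddCommMonoid W]
    [Module ℂ W] {f g : V →ₗ[ℂ] W}
    (h : ∀ μ : LieModule.Weight ℂ H V, ∀ v ∈ LieModule.weightSpace V (μ : H → ℂ), f v = g v) :
    f = g :=
  LinearMap.eqLocus_eq_top.1 (top_unique (hV.ge.trans (iSup_le h)))

theorem IsWeightModule.loopEnd_ext (hV : IsWeightModule H V) {A B : LoopEnd V}
    (h : ∀ μ : LieModule.Weight ℂ H V, ∀ v ∈ LieModule.weightSpace V (μ : H → ℂ),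
      A (1 ⊗ₜ[ℂ] v) = B (1 ⊗ₜ[ℂ] v)) : A = B := by
  refine TensorProduct.AlgebraTensorModule.curry_injective (LinearMap.ext_ring ?_)
  exact hV.linearMap_ext h

open Classical in
theorem IsWeightModule.isInternal (hV : IsWeightModule H V) :
    DirectSum.IsInternal fun μ : LieModule.Weight ℂ H V =>
      (LieModule.weightSpace V (μ : H → ℂ)).toSubmodule :=
  DirectSum.isInternal_submodule_of_iSupIndep_of_iSup_eq_top
    ((LieSubmodule.iSupIndep_toSubmodule.mpr (LieModule.iSupIndep_genWeightSpace' ℂ H V)).mono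
      fun μ => LieModule.weightSpace_le_genWeightSpace V μ) hV

open Classical in
/-- The projection of a weight module to a weight space. -/
def weightProj (hV : IsWeightModule H V) (μ : LieModule.Weight ℂ H V) : Module.End ℂ V :=
  letI := hV.isInternal.chooseDecomposition
  (LieModule.weightSpace V (μ : H → ℂ)).toSubmodule.subtype ∘ₗ
    DirectSum.component ℂ _ (fun ν : LieModule.Weight ℂ H V =>
      (LieModule.weightSpace V (ν : H → ℂ)).toSubmodule) μ ∘ₗ
    (DirectSum.decomposeLinearEquiv _).toLinearMap

variable (hV : IsWeightModule H V)

theorem weightProj_mem (μ : LieModule.Weight ℂ H V) (v : V) :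
    weightProj hV μ v ∈ LieModule.weightSpace V (μ : H → ℂ) :=
  Submodule.coe_mem (p := (LieModule.weightSpace V (μ : H → ℂ)).toSubmodule) _

theorem weightProj_of_mem {μ : LieModule.Weight ℂ H V} {v : V}
    (hv : v ∈ LieModule.weightSpace V (μ : H → ℂ)) : weightProj hV μ v = v := by
  classical
  let := hV.isInternal.chooseDecomposition
  exact DirectSum.decompose_of_mem_same (fun ν : LieModule.Weight ℂ H V =>
    (LieModule.weightSpace V (ν : H → ℂ)).toSubmodule) hv

theorem weightProj_of_mem_ne {μ ν : LieModule.Weight ℂ H V} {v : V}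
    (hv : v ∈ LieModule.weightSpace V (μ : H → ℂ)) (hμν : μ ≠ ν) : weightProj hV ν v = 0 := by
  classical
  let := hV.isInternal.chooseDecomposition
  exact DirectSum.decompose_of_mem_ne (fun ν : LieModule.Weight ℂ H V =>
    (LieModule.weightSpace V (ν : H → ℂ)).toSubmodule) hv hμν

variable [FiniteDimensional ℂ V]

theorem weightProj_sum (μ : LieModule.Weight ℂ H V) (f : LieModule.Weight ℂ H V → V) :
    weightProj hV μ (∑ ν, weightProj hV ν (f ν)) = weightProj hV μ (f μ) := by
  rw [map_sum, Finset.sum_eq_single μ (fun ν _ hν =>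
    weightProj_of_mem_ne hV (weightProj_mem hV ν _) hν) (by simp),
    weightProj_of_mem hV (weightProj_mem hV μ _)]

theorem sum_weightProj (v : V) : ∑ μ, weightProj hV μ v = v := by
  have h : ∑ μ, weightProj hV μ = LinearMap.id := hV.linearMap_ext fun μ v hv => by
    rw [LinearMap.sum_apply, Finset.sum_eq_single μ (fun ν _ hν =>
      weightProj_of_mem_ne hV hv hν.symm) (by simp), weightProj_of_mem hV hv, LinearMap.id_apply]
  rw [← LinearMap.sum_apply, h, LinearMap.id_apply]

theorem eq_zero_iff_weightProj_eq_zero {v : V} : v = 0 ↔ ∀ μ, weightProj hV μ v = 0 :=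
  ⟨fun hv μ => by rw [hv, map_zero], fun hv => by
    rw [← sum_weightProj hV v, Finset.sum_eq_zero fun μ _ => hv μ]⟩

theorem weightProj_lie (μ : LieModule.Weight ℂ H V) (h : H) (v : V) :
    weightProj hV μ ⁅h, v⁆ = μ h • weightProj hV μ v := by
  have lie_mem (w : V) (ν : LieModule.Weight ℂ H V) :
      ⁅h, weightProj hV ν w⁆ = weightProj hV ν (ν h • w) := by
    rw [map_smul, (LieModule.mem_weightSpace _ _).1 (weightProj_mem hV ν w)]
  conv_lhs => rw [← sum_weightProj hV v, lie_sum]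
  simp only [lie_mem]
  rw [weightProj_sum hV μ fun ν => ν h • v, map_smul]

end Weights

/-! ### The maximal torus -/

section Torus

variable {𝔤 : Type*} [LieRing 𝔤] [LieAlgebra ℂ 𝔤]
  {H : LieSubalgebra ℂ 𝔤} [H.IsCartanSubalgebra]
  {V : Type*} [AddCommGroup V] [Module ℂ V] [LieRingModule 𝔤 V] [LieModule ℂ 𝔤 V]

/-- The integer `μ(h)`. -/
def weightValue {h : H} (hh : h ∈ dualWeightLattice H V) (μ : LieModule.Weight ℂ H V) : ℤ :=
  (hh μ).choose

theorem coe_weightValue {h : H} (hh : h ∈ dualWeightLattice H V) (μ : LieModule.Weight ℂ H V) :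
    μ h = (weightValue hh μ : ℂ) := (hh μ).choose_spec

theorem weightValue_eq {h : H} (hh : h ∈ dualWeightLattice H V) {μ : LieModule.Weight ℂ H V}
    {n : ℤ} (hn : μ h = (n : ℂ)) : weightValue hh μ = n := by
  rw [coe_weightValue hh] at hn
  exact_mod_cast hn

variable [FiniteDimensional ℂ V] (hV : IsWeightModule H V) {h : H} (hh : h ∈ dualWeightLattice H V)

/-- The endomorphism `t^h` of `V((z))`, which multiplies vectors of weight `μ` by `t^(μ(h))`. -/
def torusEnd (t : ℂ⸨X⸩) : LoopEnd V :=
  ∑ μ, t ^ weightValue hh μ • LinearMap.baseChange ℂ⸨X⸩ (weightProj hV μ)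

theorem torusEnd_tmul (t : ℂ⸨X⸩) {μ : LieModule.Weight ℂ H V} {v : V}
    (hv : v ∈ LieModule.weightSpace V (μ : H → ℂ)) (a : ℂ⸨X⸩) :
    torusEnd hV hh t (a ⊗ₜ[ℂ] v) = (t ^ weightValue hh μ * a) ⊗ₜ[ℂ] v := by
  rw [torusEnd, LinearMap.sum_apply, Finset.sum_eq_single μ]
  · rw [LinearMap.smul_apply, LinearMap.baseChange_tmul, weightProj_of_mem hV hv,
      TensorProduct.smul_tmul', smul_eq_mul]
  · intro ν _ hν
    rw [LinearMap.smul_apply, LinearMap.baseChange_tmul, weightProj_of_mem_ne hV hv hν.symm,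
      TensorProduct.tmul_zero, smul_zero]
  · simp

theorem torusEnd_mul (s t : ℂ⸨X⸩) :
    torusEnd hV hh (s * t) = torusEnd hV hh s * torusEnd hV hh t :=
  hV.loopEnd_ext fun μ v hv => by
    rw [Module.End.mul_apply, torusEnd_tmul hV hh t hv, torusEnd_tmul hV hh s hv,
      torusEnd_tmul hV hh _ hv, mul_zpow, mul_one, mul_one]

theorem torusEnd_one : torusEnd hV hh 1 = 1 :=
  hV.loopEnd_ext fun μ v hv => by
    rw [torusEnd_tmul hV hh _ hv, one_zpow, mul_one, Module.End.one_apply]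

/-- The cocharacter `t ↦ t^h` of the maximal torus. -/
def torusHom : (ℂ⸨X⸩)ˣ →* LoopGL V :=
  Units.map
    { toFun := torusEnd hV hh
      map_one' := torusEnd_one hV hh
      map_mul' := torusEnd_mul hV hh }

theorem coe_torusHom (t : (ℂ⸨X⸩)ˣ) : (torusHom hV hh t : LoopEnd V) = torusEnd hV hh (t : ℂ⸨X⸩) :=
  rfl

theorem isTorusElement_iff {t : (ℂ⸨X⸩)ˣ} {u : LoopGL V} :
    IsTorusElement H V h t u ↔ u = torusHom hV hh t := by
  constructor
  · intro hu
    refine Units.ext (hV.loopEnd_ext fun μ v hv => ?_)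
    rw [hu μ _ (coe_weightValue hh μ) v hv, coe_torusHom, torusEnd_tmul hV hh _ hv, mul_one]
  · rintro rfl μ n hn v hv
    rw [coe_torusHom, torusEnd_tmul hV hh _ hv, weightValue_eq hh hn, mul_one]

theorem torusEnd_sub_one_mem_filteredEnd {N : ℕ} {t : (ℂ⸨X⸩)ˣ}
    (ht : t ∈ congruenceUnits (adicIdeal N)) : torusEnd hV hh t - 1 ∈ filteredEnd V N := by
  rw [← torusEnd_one hV hh, torusEnd, torusEnd, ← Finset.sum_sub_distrib]
  refine sum_mem fun μ _ => ?_
  rw [one_zpow, ← sub_smul ((t : ℂ⸨X⸩) ^ weightValue hh μ) 1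
      (LinearMap.baseChange ℂ⸨X⸩ (weightProj hV μ) : LoopEnd V),
    ← Units.val_zpow_eq_zpow_val]
  exact smul_baseChange_mem_filteredEnd (mem_adicIdeal.1 (zpow_mem ht _).1) _

theorem torusHom_mem_congruence {N : ℕ} {t : (ℂ⸨X⸩)ˣ} (ht : t ∈ congruenceUnits (adicIdeal N)) :
    torusHom hV hh t ∈ congruence V N :=
  ⟨torusEnd_sub_one_mem_filteredEnd hV hh ht, by
    rw [← map_inv]
    exact torusEnd_sub_one_mem_filteredEnd hV hh (inv_mem ht)⟩

end Torus

/-! ### Density of the convergent loops -/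

section Density

variable {𝔤 : Type*} [LieRing 𝔤] [LieAlgebra ℂ 𝔤] [FiniteDimensional ℂ 𝔤]
  {H : LieSubalgebra ℂ 𝔤} [H.IsCartanSubalgebra]
  {V : Type*} [AddCommGroup V] [Module ℂ V] [LieRingModule 𝔤 V] [LieModule ℂ 𝔤 V]

theorem chevalley_mono {T T' : Set ℂ⸨X⸩} (h : T ⊆ T') : chevalley H V T ≤ chevalley H V T' := by
  refine Subgroup.closure_mono (Set.union_subset_union ?_ ?_)
  · rintro u ⟨α, hα, x, hx, t, ht, hu⟩
    exact ⟨α, hα, x, hx, t, h ht, hu⟩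
  · rintro u ⟨k, hk, t, ht, ht0, hu⟩
    exact ⟨k, hk, t, h ht, ht0, hu⟩

theorem meroGroup_le_loopGroup : meroGroup H V ≤ loopGroup H V := chevalley_mono (Set.subset_univ _)

theorem holoGroup_le_taylorGroup : holoGroup H V ≤ taylorGroup H V :=
  inf_le_inf_right _ meroGroup_le_loopGroup

variable [FiniteDimensional ℂ V]

theorem loopGroup_le_adicClosure (hV : IsWeightModule H V) :
    loopGroup H V ≤ adicClosure (meroGroup H V) := by
  refine (Subgroup.closure_le _).2 ?_
  rintro u (⟨α, hα, x, hx, t, -, hu⟩ | ⟨h, hh, t, -, ht, hu⟩) N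
  · have hx' : IsNilpotent (LieModule.toEnd ℂ 𝔤 V x) :=
      LieModule.isNilpotent_toEnd_of_mem_rootSpace V H
        (fun h => (Finset.mem_filter.1 hα).2 h) hx
    obtain ⟨s, hs, hst⟩ := exists_convergent_le_orderTop_sub t N
    refine ⟨expUnit hx' s, Subgroup.subset_closure (Or.inl ⟨α, hα, x, hx, s, hs, rfl⟩), ?_⟩
    rw [show u = expUnit hx' t from Units.ext hu]
    exact expUnit_inv_mul_mem_congruence hx' hst
  · obtain ⟨s, hs, hst⟩ := exists_convergent_inv_mul_mem (Units.mk0 t ht) N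
    refine ⟨torusHom hV hh s, Subgroup.subset_closure (Or.inr ⟨h, hh, s, hs, s.ne_zero,
      (isTorusElement_iff hV hh).2 rfl⟩), ?_⟩
    rw [(isTorusElement_iff hV hh (t := Units.mk0 t ht)).1 hu, ← map_inv, ← map_mul]
    exact torusHom_mem_congruence hV hh hst

theorem exists_holoGroup_inv_mul_mem (hV : IsWeightModule H V) {k : LoopGL V}
    (hk : k ∈ taylorGroup H V) (N : ℕ) :
    ∃ p ∈ holoGroup H V, p⁻¹ * k ∈ congruence V N := by
  obtain ⟨p, hp, hpk⟩ := loopGroup_le_adicClosure hV hk.1 N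
  refine ⟨p, ⟨hp, ?_⟩, hpk⟩
  have := Subgroup.mul_mem _ hk.2 (Subgroup.inv_mem _ (congruence_le_stabilizer N hpk))
  rwa [mul_inv_rev, inv_inv, mul_inv_cancel_left] at this

end Density

/-! ### Flag lattices -/

section FlagLattice

variable {𝔤 : Type*} [LieRing 𝔤] [LieAlgebra ℂ 𝔤]
  {H : LieSubalgebra ℂ 𝔤} [H.IsCartanSubalgebra]
  {V : Type*} [AddCommGroup V] [Module ℂ V] [LieRingModule 𝔤 V] [LieModule ℂ 𝔤 V]
  [FiniteDimensional ℂ V] (hV : IsWeightModule H V) {h : H} (hh : h ∈ dualWeightLattice H V)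

theorem mem_flag_iff (j : ℤ) (v : V) :
    v ∈ flag V h j ↔ ∀ μ, weightValue hh μ < -j → weightProj hV μ v = 0 := by
  constructor
  · intro hv μ hμ
    refine (iSup₂_le fun s hs v hv => ?_ : flag V h j ≤ LinearMap.ker (weightProj hV μ)) hv
    have eigen : ⁅h, v⁆ = -(s : ℂ) • v := Module.End.mem_eigenspace_iff.1 hv
    have smul_eq := weightProj_lie hV μ h v
    rw [eigen, map_smul, coe_weightValue hh, ← sub_eq_zero, ← sub_smul] at smul_eq
    refine (smul_eq_zero.1 smul_eq).resolve_left fun h0 => ?_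
    have : -s - weightValue hh μ = 0 := by exact_mod_cast h0
    lia
  · intro hv
    rw [← sum_weightProj hV v]
    refine sum_mem fun μ _ => ?_
    by_cases hμ : weightValue hh μ < -j
    · rw [hv μ hμ]
      exact zero_mem _
    · refine Submodule.mem_iSup_of_mem (-weightValue hh μ)
        (Submodule.mem_iSup_of_mem (by lia) (Module.End.mem_eigenspace_iff.2 ?_))
      rw [Int.cast_neg, neg_neg, ← coe_weightValue hh]
      exact (LieModule.mem_weightSpace _ _).1 (weightProj_mem hV μ v) h

/-- The series `z` as a unit. -/
def zUnit : (ℂ⸨X⸩)ˣ :=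
  Units.mk0 zSeries fun h => one_ne_zero (HahnSeries.single_eq_zero_iff.1 h)

theorem weightProj_vcoeff_torusHom_zUnit (μ : LieModule.Weight ℂ H V) (n : ℤ)
    (s : LaurentModule V) :
    weightProj hV μ (vcoeff n (torusHom hV hh zUnit • s)) =
      weightProj hV μ (vcoeff (n - weightValue hh μ) s) := by
  have vcoeff_eq : vcoeff n (torusHom hV hh zUnit • s) =
      ∑ ν, weightProj hV ν (vcoeff (n - weightValue hh ν) s) := by
    change vcoeff n (torusEnd hV hh zSeries s) = _
    rw [torusEnd, LinearMap.sum_apply, map_sum]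
    refine Finset.sum_congr rfl fun ν _ => ?_
    rw [LinearMap.smul_apply, zSeries_zpow, vcoeff_single_smul, vcoeff_baseChange]
  rw [vcoeff_eq, weightProj_sum]

theorem mem_flagLattice_iff (s : LaurentModule V) :
    s ∈ flagLattice V h ↔ torusHom hV hh zUnit • s ∈ taylorLattice V := by
  have mem_taylorLattice_iff : torusHom hV hh zUnit • s ∈ taylorLattice V ↔
      ∀ n < 0, ∀ μ, weightProj hV μ (vcoeff (n - weightValue hh μ) s) = 0 :=
    forall₂_congr fun n _ => by
      rw [eq_zero_iff_weightProj_eq_zero hV]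
      simp only [weightProj_vcoeff_torusHom_zUnit]
  simp only [mem_taylorLattice_iff, flagLattice, Submodule.mem_iInf, Submodule.mem_comap,
    mem_flag_iff hV hh]
  refine ⟨fun hs n hn μ => hs _ μ (by lia), fun hs j μ hμ => ?_⟩
  rw [← hs (j + weightValue hh μ) (by lia) μ, add_sub_cancel_right]

theorem flagLattice_eq_smul :
    (flagLattice V h : Set (LaurentModule V)) =
      (torusHom hV hh zUnit)⁻¹ • (taylorLattice V : Set (LaurentModule V)) := by
  ext s
  rw [Set.mem_smul_set_iff_inv_smul_mem, inv_inv]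
  exact mem_flagLattice_iff hV hh s

variable [FiniteDimensional ℂ 𝔤]

theorem torusHom_zUnit_mem_meroGroup : torusHom hV hh zUnit ∈ meroGroup H V := by
  refine Subgroup.subset_closure (Or.inr ⟨h, hh, zSeries, ?_, zUnit.ne_zero,
    (isTorusElement_iff hV hh).2 rfl⟩)
  refine mem_convergent_of_coeff_eq_zero (N := 2) fun n hn => ?_
  rw [zSeries, HahnSeries.coeff_single_of_ne (by lia)]

theorem exists_holoGroup_smul_flagLattice_eq (hV : IsWeightModule H V) {h : H}
    (hh : h ∈ dualWeightLattice H V) {k : LoopGL V} (hk : k ∈ taylorGroup H V) :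
    ∃ p ∈ holoGroup H V, p • (flagLattice V h : Set (LaurentModule V)) =
      k • (flagLattice V h : Set (LaurentModule V)) := by
  obtain ⟨M, hM⟩ := exists_conj_mem_congruence (torusHom hV hh zUnit) 0
  obtain ⟨p, hp, hpk⟩ := exists_holoGroup_inv_mul_mem hV hk M
  refine ⟨p, hp, ?_⟩
  have fixes := congruence_le_stabilizer 0 (hM _ hpk)
  rw [MulAction.mem_stabilizer_iff, mul_smul, mul_smul, ← flagLattice_eq_smul hV hh,
    ← eq_inv_smul_iff, ← flagLattice_eq_smul hV hh, mul_smul, inv_smul_eq_iff] at fixes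
  exact fixes.symm

end FlagLattice

/-! ### Laurent expansions -/

theorem eq_zero_of_hasSum_pow_mul {𝕜 : Type*} [NontriviallyNormedField 𝕜] {b : ℕ → 𝕜}
    (h : ∀ᶠ w in 𝓝[≠] (0 : 𝕜), HasSum (fun n : ℕ => w ^ n * b n) 0) : b 0 = 0 := by
  classical
  -- The sum of the power series is `b 0` at the origin, `0` elsewhere, and continuous.
  let f : 𝕜 → 𝕜 := Function.update 0 0 (b 0)
  have hf : HasFPowerSeriesAt f (FormalMultilinearSeries.ofScalars 𝕜 b) 0 := by
    rw [hasFPowerSeriesAt_iff]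
    filter_upwards [eventually_nhdsWithin_iff.1 h] with w hw
    rw [zero_add]
    simp only [FormalMultilinearSeries.coeff_ofScalars, smul_eq_mul]
    rcases eq_or_ne w 0 with rfl | hw0
    · rw [show f 0 = b 0 from Function.update_self ..]
      convert! hasSum_single (f := fun n : ℕ => (0 : 𝕜) ^ n * b n) 0 fun n hn => by simp [hn]
        using 1
      simp
    · rw [show f w = 0 from Function.update_of_ne hw0 ..]
      exact hw hw0
  have hcont : Filter.Tendsto (0 : 𝕜 → 𝕜) (𝓝[≠] 0) (𝓝 (b 0)) :=
    continuousAt_update_same.1 hf.continuousAt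
  exact tendsto_nhds_unique hcont tendsto_const_nhds

theorem hasSum_pow_mul_coeff_order_add {a : ℂ⸨X⸩} {w y : ℂ} (hw : w ≠ 0)
    (h : HasSum (fun n : ℤ => w ^ n * a.coeff n) y) :
    HasSum (fun n : ℕ => w ^ n * a.coeff (a.order + n)) (w ^ (-a.order) * y) := by
  have hinj : Function.Injective fun n : ℕ => a.order + (n : ℤ) :=
    (add_right_injective _).comp Nat.cast_injective
  have hsupp : ∀ n ∉ Set.range fun n : ℕ => a.order + (n : ℤ), w ^ n * a.coeff n = 0 := by
    intro n hn
    rw [HahnSeries.coeff_eq_zero_of_lt_order, mul_zero]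
    by_contra! hle
    exact hn ⟨(n - a.order).toNat, by simp only; lia⟩
  refine (((hinj.hasSum_iff hsupp).2 h).mul_left (w ^ (-a.order))).congr_fun fun n => ?_
  rw [Function.comp_apply, ← mul_assoc, ← zpow_add₀ hw, neg_add_cancel_left, zpow_natCast]

theorem laurentSeries_eq_zero {a : ℂ⸨X⸩}
    (h : ∀ᶠ w in 𝓝[≠] (0 : ℂ), HasSum (fun n : ℤ => w ^ n * a.coeff n) 0) : a = 0 := by
  refine HahnSeries.coeff_order_eq_zero.1 ?_
  have hsum : ∀ᶠ w in 𝓝[≠] (0 : ℂ), HasSum (fun n : ℕ => w ^ n * a.coeff (a.order + n)) 0 := by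
    filter_upwards [h, self_mem_nhdsWithin] with w hw hw0
    simpa only [mul_zero] using hasSum_pow_mul_coeff_order_add hw0 hw
  simpa using eq_zero_of_hasSum_pow_mul hsum

section Expansions

variable {S : Type*} [TopologicalSpace S] [ChartedSpace ℂ S]
  {V : Type*} [AddCommGroup V] [Module ℂ V] {c : LocalCoordinates S}

theorem nhdsNE_zero_le_map_chart (c : LocalCoordinates S) (x : S) :
    𝓝[≠] (0 : ℂ) ≤ Filter.map (c.chart x) (𝓝[≠] x) := by
  rw [← c.centered x, ← OpenPartialHomeomorph.map_nhdsWithin_preimage_eq _ (c.mem_source x)]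
  exact Filter.map_mono (nhdsWithin_mono _ fun y hy h => hy (congrArg _ h))

theorem HasLaurentExpansion.unique {f : S → V} {x : S} {s t : LaurentModule V}
    (hs : HasLaurentExpansion c f x s) (ht : HasLaurentExpansion c f x t) : s = t := by
  refine ext_vcoeff fun n => ?_
  rw [← sub_eq_zero, ← Module.forall_dual_apply_eq_zero_iff ℂ]
  intro φ
  have h : component φ s - component φ t = 0 := by
    refine laurentSeries_eq_zero (Filter.Eventually.filter_mono (nhdsNE_zero_le_map_chart c x) ?_)
    rw [Filter.eventually_map]
    filter_upwards [hs, ht] with y hy hy'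
    simpa only [HahnSeries.coeff_sub, coeff_component, mul_sub, sub_self] using
      (hy φ).sub (hy' φ)
  rw [map_sub, ← coeff_component, ← coeff_component, ← HahnSeries.coeff_sub, h,
    HahnSeries.coeff_zero]

/-- The Laurent polynomial `∑ p_n z^n` with coefficients `p_n ∈ V`, as an element of `V((z))`. -/
def laurentPolynomial (p : ℤ →₀ V) : LaurentModule V :=
  p.sum fun n v => (HahnSeries.single n (1 : ℂ) : ℂ⸨X⸩) ⊗ₜ[ℂ] v

/-- The value `∑ w^n p_n` at `w ∈ ℂ` of the Laurent polynomial with coefficients `p_n ∈ V`. -/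
def laurentEval (p : ℤ →₀ V) (w : ℂ) : V := p.sum fun n v => w ^ n • v

theorem vcoeff_laurentPolynomial (n : ℤ) (p : ℤ →₀ V) : vcoeff n (laurentPolynomial p) = p n := by
  rw [laurentPolynomial, Finsupp.sum, map_sum]
  simp +contextual [HahnSeries.coeff_single, eq_comm]

theorem dual_laurentEval (φ : Module.Dual ℂ V) (p : ℤ →₀ V) (w : ℂ) :
    φ (laurentEval p w) = ∑ n ∈ p.support, w ^ n * φ (p n) := by
  rw [laurentEval, Finsupp.sum, map_sum]
  simp only [map_smul, smul_eq_mul]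

theorem hasLaurentExpansion_laurentPolynomial (c : LocalCoordinates S) (x : S) (p : ℤ →₀ V) :
    HasLaurentExpansion c (laurentEval p ∘ c.chart x) x (laurentPolynomial p) := by
  refine Filter.Eventually.of_forall fun y φ => ?_
  rw [Function.comp_apply, dual_laurentEval]
  simp only [vcoeff_laurentPolynomial]
  exact hasSum_sum_of_ne_finset_zero fun n hn => by
    rw [Finsupp.notMem_support_iff.1 hn, map_zero, mul_zero]

theorem mdifferentiableAt_dual_laurentEval (c : LocalCoordinates S) {x y : S}
    (hy : y ∈ (c.chart x).source) (hyx : y ≠ x) (φ : Module.Dual ℂ V) (p : ℤ →₀ V) :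
    MDifferentiableAt 𝓘(ℂ) 𝓘(ℂ) (fun y => φ (laurentEval p (c.chart x y))) y := by
  have hy0 : c.chart x y ≠ 0 := fun h0 =>
    hyx ((c.chart x).injOn hy (c.mem_source x) (h0.trans (c.centered x).symm))
  have hchart : MDifferentiableAt 𝓘(ℂ) 𝓘(ℂ) (c.chart x) y :=
    (contMDiffAt_of_mem_maximalAtlas (c.mem_atlas x) hy).mdifferentiableAt (by simp)
  have heval : DifferentiableAt ℂ (fun w => φ (laurentEval p w)) (c.chart x y) := by
    simp only [dual_laurentEval]
    exact DifferentiableAt.fun_sum fun n _ => (differentiableAt_zpow.2 (Or.inl hy0)).mul_const _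
  exact heval.mdifferentiableAt.comp y hchart

theorem exists_sub_laurentPolynomial_mem_filtration (s : LaurentModule V) (N : ℤ) :
    ∃ p : ℤ →₀ V, s - laurentPolynomial p ∈ filtration V N := by
  classical
  obtain ⟨M, hM⟩ := exists_mem_filtration s
  refine ⟨Finsupp.onFinset (Finset.Ico M N) (fun n => if n ∈ Finset.Ico M N then vcoeff n s else 0)
    (by simp +contextual), fun n hn => ?_⟩
  rw [map_sub, vcoeff_laurentPolynomial, Finsupp.onFinset_apply]
  split_ifs with h
  · exact sub_self _
  · rw [hM n (by rw [Finset.mem_Ico] at h; lia), sub_zero]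

end Expansions

/-! ### Stalks of the sheaf of sections -/

section Sections

variable {V : Type*} [AddCommGroup V] [Module ℂ V]

/-- A set of Laurent series is uniformly open if membership depends only on the coefficients below
a fixed index, i.e. if it is a union of cosets of some `z^N V[[z]]`. -/
def IsUniformlyOpen (L : Set (LaurentModule V)) : Prop :=
  ∃ N, ∀ s t, s - t ∈ filtration V N → (s ∈ L ↔ t ∈ L)

theorem isUniformlyOpen_taylorLattice :
    IsUniformlyOpen (taylorLattice V : Set (LaurentModule V)) := by
  refine ⟨0, fun s t hst => forall₂_congr fun n hn => ?_⟩
  rw [sub_eq_zero.1 ((map_sub (vcoeff n) s t).symm.trans (hst n hn))]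

theorem IsUniformlyOpen.smul [FiniteDimensional ℂ V] {L : Set (LaurentModule V)}
    (hL : IsUniformlyOpen L) (g : LoopGL V) : IsUniformlyOpen (g • L) := by
  obtain ⟨N, hN⟩ := hL
  obtain ⟨p, hp⟩ := exists_mem_filteredEnd ((g⁻¹ : LoopGL V) : LoopEnd V)
  refine ⟨N - p, fun s t hst => ?_⟩
  rw [Set.mem_smul_set_iff_inv_smul_mem, Set.mem_smul_set_iff_inv_smul_mem]
  refine hN _ _ ?_
  have h : g⁻¹ • (s - t) ∈ filtration V (N - p + p) := hp _ _ hst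
  rwa [smul_sub, sub_add_cancel] at h

variable {S : Type*} [TopologicalSpace S] [ChartedSpace ℂ S] [T1Space S]

theorem exists_isLocalSection_laurentPolynomial (c : LocalCoordinates S) (Γ : Finset S) (γ : Γ)
    (p : ℤ →₀ V) :
    ∃ (U : TopologicalSpace.Opens S) (f : S → V), (γ : S) ∈ U ∧
      HasLaurentExpansion c f γ (laurentPolynomial p) ∧
      ∀ L : Γ → Set (LaurentModule V), laurentPolynomial p ∈ L γ → IsLocalSection c Γ L U f := by
  have hopen : IsOpen ((c.chart γ).source \ ((Γ : Set S) \ {(γ : S)})) :=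
    (c.chart γ).open_source.sdiff (Γ.finite_toSet.subset Set.sdiff_subset).isClosed
  have hp := hasLaurentExpansion_laurentPolynomial c (γ : S) p
  refine ⟨⟨_, hopen⟩, laurentEval p ∘ c.chart γ, ⟨c.mem_source γ, fun h => h.2 rfl⟩, hp,
    fun L hL => ⟨fun φ y hy => ?_, ?_⟩⟩
  · have hyγ : y ≠ γ := fun h => hy.2 (h ▸ γ.2)
    exact (mdifferentiableAt_dual_laurentEval c hy.1.1 hyγ φ p).mdifferentiableWithinAt
  · rintro δ ⟨-, hδ⟩
    obtain rfl : δ = γ := by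
      by_contra hne
      exact hδ ⟨δ.2, fun h => hne (Subtype.ext h)⟩
    exact ⟨_, hL, hp⟩

variable {c : LocalCoordinates S} {Γ : Finset S} {L L' : Γ → Set (LaurentModule V)}

theorem subset_of_isLocalSection_imp (hL : ∀ γ, IsUniformlyOpen (L γ))
    (hL' : ∀ γ, IsUniformlyOpen (L' γ))
    (h : ∀ U f, IsLocalSection c Γ L U f → IsLocalSection c Γ L' U f) (γ : Γ) : L γ ⊆ L' γ := by
  intro s hs
  obtain ⟨N, hN⟩ := hL γ
  obtain ⟨N', hN'⟩ := hL' γ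
  obtain ⟨p, hp⟩ := exists_sub_laurentPolynomial_mem_filtration s (max N N')
  have hpL := (hN s _ (filtration_antitone (le_max_left N N') hp)).1 hs
  obtain ⟨U, f, hγU, hf, hsec⟩ := exists_isLocalSection_laurentPolynomial c Γ γ p
  obtain ⟨t, ht, hft⟩ := (h U f (hsec L hpL)).2 γ hγU
  rw [← hf.unique hft] at ht
  exact (hN' s _ (filtration_antitone (le_max_right N N') hp)).2 ht

theorem isLocalSection_iff_iff_eq (hL : ∀ γ, IsUniformlyOpen (L γ))
    (hL' : ∀ γ, IsUniformlyOpen (L' γ)) :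
    (∀ U f, IsLocalSection c Γ L U f ↔ IsLocalSection c Γ L' U f) ↔ L = L' := by
  refine ⟨fun h => funext fun γ => Set.Subset.antisymm ?_ ?_, fun h _ _ => by rw [h]⟩
  · exact subset_of_isLocalSection_imp hL hL' (fun U f => (h U f).1) γ
  · exact subset_of_isLocalSection_imp hL' hL (fun U f => (h U f).2) γ

end Sections

/-! ### Constant loops -/

section Constants

variable {V : Type*} [AddCommGroup V] [Module ℂ V]

theorem vcoeff_constGL_smul (g : LinearMap.GeneralLinearGroup ℂ V) (n : ℤ) (s : LaurentModule V) :
    vcoeff n (constGL V g • s) = g • vcoeff n s :=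
  vcoeff_baseChange (g : Module.End ℂ V) n s

theorem constGL_mem_stabilizer (g : LinearMap.GeneralLinearGroup ℂ V) :
    constGL V g ∈ MulAction.stabilizer (LoopGL V) (taylorLattice V : Set (LaurentModule V)) := by
  refine MulAction.mem_stabilizer_set.2 fun s => forall₂_congr fun n _ => ?_
  rw [vcoeff_constGL_smul, smul_eq_zero_iff_eq]

variable {S : Type*} [TopologicalSpace S] [ChartedSpace ℂ S] {c : LocalCoordinates S}

theorem HasLaurentExpansion.const_smul {f : S → V} {x : S} {s : LaurentModule V}
    (hs : HasLaurentExpansion c f x s) (g : LinearMap.GeneralLinearGroup ℂ V) :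
    HasLaurentExpansion c (fun y => g • f y) x (constGL V g • s) := by
  filter_upwards [hs] with y hy φ
  simp only [vcoeff_constGL_smul]
  exact hy (φ ∘ₗ (g : Module.End ℂ V))

theorem IsLocalSection.const_smul {Γ : Finset S} {L : Γ → Set (LaurentModule V)}
    {U : TopologicalSpace.Opens S} {f : S → V} (hf : IsLocalSection c Γ L U f)
    (g : LinearMap.GeneralLinearGroup ℂ V) :
    IsLocalSection c Γ (constGL V g • L) U fun y => g • f y := by
  refine ⟨fun φ => hf.1 (φ ∘ₗ (g : Module.End ℂ V)), fun γ hγ => ?_⟩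
  obtain ⟨s, hs, hfs⟩ := hf.2 γ hγ
  exact ⟨_, Set.smul_mem_smul_set hs, hfs.const_smul g⟩

theorem isLocalSection_const_smul_iff {Γ : Finset S} {L : Γ → Set (LaurentModule V)}
    {U : TopologicalSpace.Opens S} {f : S → V} (g : LinearMap.GeneralLinearGroup ℂ V) :
    IsLocalSection c Γ (constGL V g • L) U (fun y => g • f y) ↔ IsLocalSection c Γ L U f := by
  refine ⟨fun h => ?_, fun h => h.const_smul g⟩
  simpa only [map_inv, inv_smul_smul] using h.const_smul g⁻¹

end Constants

/-! ### The moduli space as an orbit of lattices -/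

section Moduli

variable {𝔤 : Type*} [LieRing 𝔤] [LieAlgebra ℂ 𝔤] [FiniteDimensional ℂ 𝔤]
  {H : LieSubalgebra ℂ 𝔤} [H.IsCartanSubalgebra]
  {V : Type*} [AddCommGroup V] [Module ℂ V] [LieRingModule 𝔤 V] [LieModule ℂ 𝔤 V]
  {S : Type*} {Γ : Finset S}

theorem constGL_mem_taylorGroup {g : LinearMap.GeneralLinearGroup ℂ V} (hg : g ∈ constGroup H V) :
    constGL V g ∈ taylorGroup H V :=
  ⟨chevalley_mono (Set.subset_univ _) hg, constGL_mem_stabilizer g⟩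

variable (V) in
/-- The family of the lattices `F_{h_γ}`, `γ ∈ Γ`. -/
def flagLattices (h : Γ → H) : Γ → Set (LaurentModule V) := fun γ => flagLattice V (h γ)

theorem K₀_eq_stabilizer (h : Γ → H) :
    K₀ V h = MulAction.stabilizer (Γ → taylorGroup H V) (flagLattices V h) := by
  ext k
  rw [K₀, Subgroup.mem_pi, MulAction.mem_stabilizer_iff, funext_iff]
  simp only [Set.mem_univ, forall_const]
  exact forall_congr' fun γ => and_iff_right (k γ).2.1

theorem GermDistribution.stalk_eq_smul (Ψ : GermDistribution H V Γ) (γ : Γ) :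
    Ψ.stalk γ = (Ψ.germ γ)⁻¹ • (taylorLattice V : Set (LaurentModule V)) := by
  ext s
  rw [Set.mem_smul_set_iff_inv_smul_mem, inv_inv]
  rfl

theorem GermDistribution.smul_stalk_eq_stalk_iff (k : Γ → taylorGroup H V)
    (Ψ Ψ' : GermDistribution H V Γ) :
    k • Ψ.stalk = Ψ'.stalk ↔
      ∀ γ : Γ, Ψ'.germ γ * (k γ : LoopGL V) * (Ψ.germ γ)⁻¹ ∈ taylorGroup H V := by
  refine funext_iff.trans (forall_congr' fun γ => ?_)
  have mem_loopGroup : Ψ'.germ γ * (k γ : LoopGL V) * (Ψ.germ γ)⁻¹ ∈ loopGroup H V :=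
    mul_mem (mul_mem (meroGroup_le_loopGroup (Ψ'.mem_mero γ)) (k γ).2.1)
      (inv_mem (meroGroup_le_loopGroup (Ψ.mem_mero γ)))
  refine Iff.trans ?_ (Subgroup.mem_inf.trans (and_iff_right mem_loopGroup)).symm
  rw [MulAction.mem_stabilizer_iff, mul_smul, mul_smul, ← eq_inv_smul_iff, ← Ψ.stalk_eq_smul,
    ← Ψ'.stalk_eq_smul]
  rfl

/-- The distribution with germs `a γ` at the points of `Γ` and trivial elsewhere. -/
def GermDistribution.ofMeroGroup (a : Γ → meroGroup H V) : GermDistribution H V Γ where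
  germ x := (Function.extend Subtype.val a 1 x : meroGroup H V)
  mem_mero x := Subtype.coe_prop _
  mem_holo x hx := by
    rw [Function.extend_apply' _ _ _ fun ⟨γ, hγ⟩ => hx (hγ ▸ γ.2)]
    exact one_mem _

theorem GermDistribution.ofMeroGroup_germ (a : Γ → meroGroup H V) (γ : Γ) :
    (ofMeroGroup a).germ γ = a γ :=
  congrArg Subtype.val (Subtype.val_injective.extend_apply a 1 γ)

variable [FiniteDimensional ℂ V]

theorem GermDistribution.HasInvariants.stalk_mem_orbit {Ψ : GermDistribution H V Γ} {h : Γ → H}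
    (hΨ : Ψ.HasInvariants h) (hV : IsWeightModule H V) (hh : ∀ γ, h γ ∈ dualWeightLattice H V) :
    Ψ.stalk ∈ MulAction.orbit (Γ → taylorGroup H V) (flagLattices V h) := by
  choose k hk k' hk' u hu hΨu using hΨ
  refine ⟨fun γ => ⟨k' γ, holoGroup_le_taylorGroup (hk' γ)⟩⁻¹, funext fun γ => ?_⟩
  have fixes : (k γ)⁻¹ • (taylorLattice V : Set (LaurentModule V)) = taylorLattice V :=
    (inv_mem (hk γ)).2
  rw [Ψ.stalk_eq_smul, hΨu, mul_inv_rev, mul_inv_rev, mul_smul, mul_smul, fixes,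
    (isTorusElement_iff hV (hh γ) (t := zUnit)).1 (hu γ), ← flagLattice_eq_smul hV (hh γ)]
  rfl

theorem exists_hasInvariants_stalk_eq_smul {h : Γ → H} (hV : IsWeightModule H V)
    (hh : ∀ γ, h γ ∈ dualWeightLattice H V) (k : Γ → taylorGroup H V) :
    ∃ Ψ : GermDistribution H V Γ, Ψ.HasInvariants h ∧ Ψ.stalk = k • flagLattices V h := by
  choose p hp hpk using fun γ => exists_holoGroup_smul_flagLattice_eq hV (hh γ) (k γ).2
  let Ψ : GermDistribution H V Γ := .ofMeroGroup fun γ =>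
    ⟨torusHom hV (hh γ) zUnit * (p γ)⁻¹,
      mul_mem (torusHom_zUnit_mem_meroGroup hV (hh γ)) (inv_mem (hp γ).1)⟩
  have germ_eq (γ : Γ) : Ψ.germ γ = torusHom hV (hh γ) zUnit * (p γ)⁻¹ :=
    GermDistribution.ofMeroGroup_germ _ γ
  refine ⟨Ψ, fun γ => ⟨1, one_mem _, (p γ)⁻¹, inv_mem (hp γ), torusHom hV (hh γ) zUnit,
    (isTorusElement_iff hV (hh γ) (t := zUnit)).2 rfl, ?_⟩, funext fun γ => ?_⟩
  · rw [germ_eq, one_mul]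
  · rw [Ψ.stalk_eq_smul, germ_eq, mul_inv_rev, inv_inv, mul_smul,
      ← flagLattice_eq_smul hV (hh γ), hpk]
    rfl

variable [LieAlgebra.IsSemisimple ℂ 𝔤]

theorem MatrixDivisor.isUniformlyOpen_stalk (D : MatrixDivisor H V Γ) (γ : Γ) :
    IsUniformlyOpen (D.stalk γ) := by
  induction D using Quotient.inductionOn with
  | h Ψ =>
    change IsUniformlyOpen (Ψ.stalk γ)
    rw [Ψ.stalk_eq_smul]
    exact isUniformlyOpen_taylorLattice.smul _

variable [TopologicalSpace S] [ChartedSpace ℂ S] {c : LocalCoordinates S} {h : Γ → H}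

theorem GermDistribution.toModuli_surjective (m : ModuliSpace V c h) :
    ∃ (Ψ : GermDistribution H V Γ) (hΨ : Ψ.HasInvariants h), Ψ.toModuli c hΨ = m := by
  obtain ⟨⟨D, hD⟩, rfl⟩ := Quotient.exists_rep m
  obtain ⟨Ψ, rfl⟩ := Quotient.exists_rep D
  exact ⟨Ψ, hD, rfl⟩

variable [T1Space S]

theorem MatrixDivisor.isSection_iff_iff_stalk_eq {D D' : MatrixDivisor H V Γ} :
    (∀ U f, D.IsSection c U f ↔ D'.IsSection c U f) ↔ D.stalk = D'.stalk :=
  isLocalSection_iff_iff_eq D.isUniformlyOpen_stalk D'.isUniformlyOpen_stalk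

/-- The stalks at the points of `Γ` of the sheaf of sections of a point of the moduli space. -/
def ModuliSpace.stalk (m : ModuliSpace V c h) : Γ → Set (LaurentModule V) :=
  Quotient.lift (fun D : {D : MatrixDivisor H V Γ // D.HasInvariants h} => D.1.stalk)
    (fun _ _ hD => MatrixDivisor.isSection_iff_iff_stalk_eq.1 hD) m

theorem ModuliSpace.isSection_iff (m : ModuliSpace V c h) (U : TopologicalSpace.Opens S)
    (f : S → V) : m.IsSection U f ↔ IsLocalSection c Γ m.stalk U f := by
  obtain ⟨Ψ, hΨ, rfl⟩ := GermDistribution.toModuli_surjective m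
  rfl

theorem ModuliSpace.isUniformlyOpen_stalk (m : ModuliSpace V c h) (γ : Γ) :
    IsUniformlyOpen (m.stalk γ) := by
  obtain ⟨Ψ, hΨ, rfl⟩ := GermDistribution.toModuli_surjective m
  exact Ψ.toDivisor.isUniformlyOpen_stalk γ

theorem ModuliSpace.stalk_injective :
    Function.Injective (ModuliSpace.stalk (V := V) (c := c) (h := h)) := by
  intro m m' hm
  obtain ⟨Ψ, hΨ, rfl⟩ := GermDistribution.toModuli_surjective m
  obtain ⟨Ψ', hΨ', rfl⟩ := GermDistribution.toModuli_surjective m'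
  exact Quotient.sound (MatrixDivisor.isSection_iff_iff_stalk_eq.2 hm)

theorem ModuliSpace.isShift_iff (g : LinearMap.GeneralLinearGroup ℂ V) (m m' : ModuliSpace V c h) :
    ModuliSpace.IsShift g m m' ↔ constGL V g • m.stalk = m'.stalk := by
  have isUniformlyOpen_smul (γ : Γ) : IsUniformlyOpen ((constGL V g • m.stalk) γ) :=
    (m.isUniformlyOpen_stalk γ).smul (constGL V g)
  rw [← isLocalSection_iff_iff_eq (c := c) isUniformlyOpen_smul m'.isUniformlyOpen_stalk]
  refine forall_congr' fun U => ?_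
  have shift_surjective : Function.Surjective fun (f : S → V) y => g • f y := fun f =>
    ⟨fun y => g⁻¹ • f y, funext fun y => smul_inv_smul g (f y)⟩
  refine Iff.trans ?_ shift_surjective.forall.symm
  refine forall_congr' fun f => ?_
  rw [m.isSection_iff, m'.isSection_iff, isLocalSection_const_smul_iff]

/-- The moduli space as the `K^Γ`-orbit of the family of lattices `F_{h_γ}`: a point is sent to the
stalks of its sheaf of sections. -/
def moduliEquivOrbit (c : LocalCoordinates S) (hV : IsWeightModule H V)
    (hh : ∀ γ, h γ ∈ dualWeightLattice H V) :
    ModuliSpace V c h ≃ MulAction.orbit (Γ → taylorGroup H V) (flagLattices V h) :=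
  Equiv.ofBijective
    (Set.codRestrict ModuliSpace.stalk _ fun m => by
      obtain ⟨Ψ, hΨ, rfl⟩ := GermDistribution.toModuli_surjective m
      exact hΨ.stalk_mem_orbit hV hh)
    ⟨ModuliSpace.stalk_injective.codRestrict _, by
      rintro ⟨_, k, rfl⟩
      obtain ⟨Ψ, hΨ, stalk_eq⟩ := exists_hasInvariants_stalk_eq_smul hV hh k
      exact ⟨Ψ.toModuli c hΨ, Subtype.ext stalk_eq⟩⟩

theorem stalk_moduliEquivOrbit_symm (hV : IsWeightModule H V)
    (hh : ∀ γ, h γ ∈ dualWeightLattice H V)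
    (x : MulAction.orbit (Γ → taylorGroup H V) (flagLattices V h)) :
    ((moduliEquivOrbit c hV hh).symm x).stalk = x :=
  congrArg Subtype.val ((moduliEquivOrbit c hV hh).apply_symm_apply x)

/-- The action of `K^Γ` on the moduli space that corresponds to its action on stalks. -/
abbrev moduliAction (c : LocalCoordinates S) (hV : IsWeightModule H V)
    (hh : ∀ γ, h γ ∈ dualWeightLattice H V) :
    MulAction (Γ → taylorGroup H V) (ModuliSpace V c h) :=
  (moduliEquivOrbit c hV hh).mulAction _

theorem stalk_smul (hV : IsWeightModule H V) (hh : ∀ γ, h γ ∈ dualWeightLattice H V)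
    (k : Γ → taylorGroup H V) (m : ModuliSpace V c h) :
    letI := moduliAction c hV hh
    (k • m).stalk = k • m.stalk :=
  stalk_moduliEquivOrbit_symm hV hh _

/-- The orbit map `K^Γ / K_0 ≃ K^Γ • (F_{h_γ})_γ`, read in the moduli space. -/
def quotientEquivModuli (c : LocalCoordinates S) (hV : IsWeightModule H V)
    (hh : ∀ γ, h γ ∈ dualWeightLattice H V) :
    ((Γ → taylorGroup H V) ⧸ K₀ V h) ≃ ModuliSpace V c h :=
  ((Subgroup.quotientEquivOfEq (K₀_eq_stabilizer h)).trans
    (MulAction.orbitEquivQuotientStabilizer _ (flagLattices V h)).symm).trans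
      (moduliEquivOrbit c hV hh).symm

theorem stalk_quotientEquivModuli_mk (hV : IsWeightModule H V)
    (hh : ∀ γ, h γ ∈ dualWeightLattice H V) (k : Γ → taylorGroup H V) :
    (quotientEquivModuli c hV hh (QuotientGroup.mk k)).stalk = k • flagLattices V h :=
  stalk_moduliEquivOrbit_symm hV hh _

end Moduli
end MatrixDivisors
end

open MatrixDivisors in
theorem mainTheorem3_general
    {𝔤 : Type*} [LieRing 𝔤] [LieAlgebra ℂ 𝔤] [FiniteDimensional ℂ 𝔤] [LieAlgebra.IsSemisimple ℂ 𝔤]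
    {H : LieSubalgebra ℂ 𝔤} [H.IsCartanSubalgebra]
    {V : Type*} [AddCommGroup V] [Module ℂ V] [LieRingModule 𝔤 V] [LieModule ℂ 𝔤 V]
    [FiniteDimensional ℂ V] (hV : IsWeightModule H V)
    {S : Type*} [TopologicalSpace S] [T1Space S] [ChartedSpace ℂ S] (c : LocalCoordinates S)
    {Γ : Finset S} {h : Γ → H} (hh : ∀ γ, h γ ∈ dualWeightLattice H V) :
    ∃ (_ : MulAction (Γ → taylorGroup H V) (ModuliSpace V c h))
      (e : ((Γ → taylorGroup H V) ⧸ K₀ V h) ≃ ModuliSpace V c h),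
      (∀ (k : Γ → taylorGroup H V) (Ψ Ψ' : GermDistribution H V Γ)
          (hΨ : Ψ.HasInvariants h) (hΨ' : Ψ'.HasInvariants h),
        k • Ψ.toModuli c hΨ = Ψ'.toModuli c hΨ' ↔
          ∀ γ : Γ, Ψ'.germ γ * (k γ : LoopGL V) * (Ψ.germ γ)⁻¹ ∈ taylorGroup H V) ∧
      (∀ (k : Γ → taylorGroup H V) (x : (Γ → taylorGroup H V) ⧸ K₀ V h), e (k • x) = k • e x) ∧
      (∀ (k : Γ → taylorGroup H V) (U : TopologicalSpace.Opens S) (f : S → V),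
        (e (QuotientGroup.mk k)).IsSection U f ↔
          IsLocalSection c Γ
            (fun γ => (k γ : LoopGL V) • (flagLattice V (h γ) : Set (LaurentModule V))) U f) ∧
      (∀ g ∈ constGroup H V, ∀ m m' : ModuliSpace V c h,
        ModuliSpace.IsShift g m m' ↔
          ∃ κ : taylorGroup H V, (κ : LoopGL V) = constGL V g ∧
            (fun _ : Γ => κ) • m = m') := by
  let _ := moduliAction c hV hh
  have stalk_smul := stalk_smul (c := c) hV hh
  have stalk_mk := stalk_quotientEquivModuli_mk (c := c) hV hh
  refine ⟨moduliAction c hV hh, quotientEquivModuli c hV hh, fun k Ψ Ψ' hΨ hΨ' => ?_,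
    fun k x => ?_, fun k U f => ?_, fun g hg m m' => ?_⟩
  · rw [← ModuliSpace.stalk_injective.eq_iff, stalk_smul]
    exact GermDistribution.smul_stalk_eq_stalk_iff k Ψ Ψ'
  · obtain ⟨k', rfl⟩ := QuotientGroup.mk_surjective x
    refine ModuliSpace.stalk_injective ?_
    rw [stalk_smul, stalk_mk, ← mul_smul]
    exact stalk_mk (k * k')
  · rw [ModuliSpace.isSection_iff, stalk_mk]
    rfl
  · simp only [ModuliSpace.isShift_iff, ← ModuliSpace.stalk_injective.eq_iff, stalk_smul]
    constructor
    · exact fun hs => ⟨⟨constGL V g, constGL_mem_taylorGroup hg⟩, rfl, hs⟩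
    · rintro ⟨κ, hκ, hs⟩
      rw [← hκ]
      exact hs

open scoped Manifold ContDiff Pointwise in
open MatrixDivisors in
theorem mainTheorem3
    {𝔤 : Type*} [LieRing 𝔤] [LieAlgebra ℂ 𝔤] [FiniteDimensional ℂ 𝔤] [LieAlgebra.IsSemisimple ℂ 𝔤]
    (H : LieSubalgebra ℂ 𝔤) [H.IsCartanSubalgebra]
    (b : (LieAlgebra.IsKilling.rootSystem H).Base)
    (V : Type*) [AddCommGroup V] [Module ℂ V] [LieRingModule 𝔤 V] [LieModule ℂ 𝔤 V]
    [FiniteDimensional ℂ V] [LieModule.IsIrreducible ℂ 𝔤 V] [LieModule.IsFaithful ℂ 𝔤 V]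
    (χ : Module.Dual ℂ H) (_hχ : IsHighestWeight V b χ)
    {S : Type*} [TopologicalSpace S] [T2Space S] [ConnectedSpace S] [ChartedSpace ℂ S]
    [IsManifold 𝓘(ℂ) ω S] (c : LocalCoordinates S)
    (Γ : Finset S) (h : Γ → H) (_hh : ∀ γ, h γ ∈ dominantChamber V b) :
    ∃ (_ : MulAction (Γ → taylorGroup H V) (ModuliSpace V c h))
      (e : ((Γ → taylorGroup H V) ⧸ K₀ V h) ≃ ModuliSpace V c h),
      -- the action is `(k, Ψ) ↦ Ψ k⁻¹`, up to left multiplication by elements of `K`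
      (∀ (k : Γ → taylorGroup H V) (Ψ Ψ' : GermDistribution H V Γ)
          (hΨ : Ψ.HasInvariants h) (hΨ' : Ψ'.HasInvariants h),
        k • Ψ.toModuli c hΨ = Ψ'.toModuli c hΨ' ↔
          ∀ γ : Γ, Ψ'.germ γ * (k γ : LoopGL V) * (Ψ.germ γ)⁻¹ ∈ taylorGroup H V) ∧
      -- `e` is an isomorphism of sets with an action of `∏ K`
      (∀ (k : Γ → taylorGroup H V) (x : (Γ → taylorGroup H V) ⧸ K₀ V h), e (k • x) = k • e x) ∧
      -- `e` sends the coset of `k` to the divisor whose flag at `γ` is the image under `k γ` of the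
      -- flag determined by `h γ`
      (∀ (k : Γ → taylorGroup H V) (U : TopologicalSpace.Opens S) (f : S → V),
        (e (QuotientGroup.mk k)).IsSection U f ↔
          IsLocalSection c Γ
            (fun γ => (k γ : LoopGL V) • (flagLattice V (h γ) : Set (LaurentModule V))) U f) ∧
      -- shifts of sheaves of sections by constants correspond to the diagonal action of `G(ℂ)`
      (∀ g ∈ constGroup H V, ∀ m m' : ModuliSpace V c h,
        ModuliSpace.IsShift g m m' ↔
          ∃ κ : taylorGroup H V, (κ : LoopGL V) = constGL V g ∧
            (fun _ : Γ => κ) • m = m') := by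
  obtain ⟨v, hv, hv0, -⟩ := _hχ
  exact mainTheorem3_general (IsWeightModule.of_isIrreducible hv hv0) c fun γ => (_hh γ).1
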